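/- **Setting.** For $\mu\in\mathbb R^m$ and a positive definite $K\in\mathbb R^{m\times m}$ let $\mathrm{TN}(\mu,K)$ be the distribution on $[0,\infty)^m$ with density proportional to $\exp\{-\tfrac12(x-\mu)^\top K(x-\mu)\}$. Let the rows $X^{(1)},\dots,X^{(n)}$ of the data matrix $\mathbf x\in\mathbb R^{n\times m}$ be i.i.d. copies of $X\sim\mathrm{TN}(\mu_0,K_0)$, put $\eta_0=K_0\mu_0$, and let $\Psi_0\in\mathbb R^{(m+1)\times m}$ be the matrix with upper block $K_0$ and last row $\eta_0^\top$. Probabilities and expectations $\mathbb E_0$ are under this distribution. Let $h=(h_1,\dots,h_m)$ be in $\mathcal H_{1,1}$, i.e. each $h_j:[0,\infty)\to[0,\infty)$ is absolutely continuous on bounded intervals, a.e. positive, $h_j$ and $h_j'$ are a.e. bounded by piecewise powers of $x$, and $\lim_{x\searrow0}h_j(x)=0$. Assume $0\le h_j\le M$ and $0\le h_j'\le M'$ a.e. for constants $M,M'$. Index vectors of length $(m+1)m$ by the entries $(k,j)$ of an $(m+1)\times m$ matrix. Let $\Gamma(\mathbf x)$ be the block-diagonal matrix whose $j$-th block (belonging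 to column $j$) is $$\frac1n\sum_{i=1}^n h_j(X^{(i)}_j)\begin{pmatrix}X^{(i)}\\-1\end{pmatrix}\begin{pmatrix}X^{(i)}\\-1\end{pmatrix}^{\!\top},$$ and let $g(\mathbf x)$ have entries $\frac1n\sum_i\big(h_j'(X^{(i)}_j)X^{(i)}_k+1_{\{k=j\}}h_j(X_j^{(i)})\big)$ for $k\le m$ and $-\frac1n\sum_i h_j'(X_j^{(i)})$ for $k=m+1$. For $\delta>1$ let $\Gamma_\gamma(\mathbf x)=\Gamma(\mathbf x)+\mathrm{diag}(\gamma)$, where $\gamma$ equals $(\delta-1)$ times the diagonal of $\Gamma(\mathbf x)$ at the entries with $k\le m$ (the $K$-entries) and $0$ at the entries with $k=m+1$. The estimator $\hat\Psi$, with upper block $\hat K$ and last row $\hat\eta^\top$, is a minimizer over all $\Psi\in\mathbb R^{(m+1)\times m}$ of $$\tfrac12\mathrm{vec}(\Psi)^\top\Gamma_\gamma(\mathbf x)\mathrm{vec}(\Psi)-g(\mathbf x)^\top\mathrm{vec}(\Psi)+\lambda\sum_{k,j}|\Psi_{kj}| .$$ Write $S(\Psi)=\{(k,j):\Psi_{kj}\ne0\}$,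 $S_0=S(\Psi_0)$, $\Gamma_0=\mathbb E_0\Gamma(\mathbf x)$, and let $\|A\|_{\infty,\infty}=\max_a\sum_b|A_{ab}|$. Let $d$ be the maximal number of non-zero entries in a column of $\Psi_0$, $c_{\Psi_0}=\|\Psi_0^\top\|_{\infty,\infty}$, $c_{\Gamma_0}=\|(\Gamma_{0,S_0S_0})^{-1}\|_{\infty,\infty}$, $$c_X=2\max_j\Big(2\sqrt{(K_0^{-1})_{jj}}+\sqrt e\,\mathbb E_0X_j\Big),\qquad \bar c_X=\max\{1,c_X\},$$ $$C(n,m)=2-\Big(1+4e\max\{6\log m/n,\sqrt{6\log m/n}\}\Big)^{-1}.$$ **Theorem.** There are absolute constants $C_1,C_2>0$ such that the following holds in the above setting. Let $1<\delta<C(n,m)$, $\alpha\in(0,1]$, $\tau>3$. Suppose $\Gamma_{0,S_0S_0}$ is invertible, $\|\Gamma_{0,S_0^cS_0}(\Gamma_{0,S_0S_0})^{-1}\|_{\infty,\infty}\le1-\alpha$, and $$n>C_1\,\tau\log m\,\max\Big\{\frac{M^2c_{\Gamma_0}^2\bar c_X^4d^2}{\alpha^2},\frac{Mc_{\Gamma_0}\bar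 c_X^2d}{\alpha}\Big\},$$ $$\lambda>C_2\,\frac{2-\alpha}{\alpha}\,\big(Mc_{\Psi_0}\bar c_X^2+M'\bar c_X+M\big)\Big(\sqrt{\frac{\tau\log m}{n}}+\frac{\tau\log m}{n}\Big).$$ Put $B=\frac{2c_{\Gamma_0}}{2-\alpha}\lambda$. Then with probability at least $1-m^{3-\tau}$ all of the following hold. (a) The minimizer $\hat\Psi$ exists and is unique, $S(\hat\Psi)\subseteq S_0$, and $$\|\hat K-K_0\|_\infty\le B,\qquad \|\hat\eta-\eta_0\|_\infty\le B\qquad\text{(entrywise maximum norms)},$$ $$\|\hat K-K_0\|_F\le B\sqrt{|S_0|},\qquad \|\hat\eta-\eta_0\|_F\le B\sqrt{|S_0|},$$ $$\|\hat K-K_0\|_2\le B\min\{\sqrt{|S_0|},d\},\qquad \|\hat\eta-\eta_0\|_2\le B\sqrt{|\{j:\eta_{0,j}\ne0\}|},$$ where $\|\cdot\|_F$ is the Frobenius norm and $\|\cdot\|_2$ the spectral norm (for a vector both are the Euclidean norm). (b) If moreover $|\kappa_{0,kj}|>B$ for all non-zero entries $\kappa_{0,kj}$ of $K_0$ and $|\eta_{0,j}|>B$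 for all non-zero entries of $\eta_0$, then $S(\hat\Psi)=S_0$, $\mathrm{sign}(\hat\kappa_{kj})=\mathrm{sign}(\kappa_{0,kj})$ whenever $\kappa_{0,kj}\ne0$, and $\mathrm{sign}(\hat\eta_j)=\mathrm{sign}(\eta_{0,j})$ whenever $\eta_{0,j}\ne0$. -/

import Mathlib

open MeasureTheory ProbabilityTheory Set Filter Topology Matrix

noncomputable section

namespace TruncGGM

/-! ### Norms, supports and sparsity -/

/-- The `ℓ∞`-`ℓ∞` operator norm of a matrix: the maximal absolute row sum. -/
def rowSumNorm {ι κ : Type*} [Fintype κ] (A : Matrix ι κ ℝ) : ℝ :=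
  ⨆ i, ∑ j, |A i j|

/-- The Frobenius norm. -/
def frobNorm {ι κ : Type*} [Fintype ι] [Fintype κ] (A : Matrix ι κ ℝ) : ℝ :=
  Real.sqrt (∑ i, ∑ j, A i j ^ 2)

/-- The spectral norm of a square matrix, i.e. its `ℓ2`-`ℓ2` operator norm. -/
def specNorm {m : ℕ} (A : Matrix (Fin m) (Fin m) ℝ) : ℝ :=
  ‖Matrix.toEuclideanCLM (n := Fin m) (𝕜 := ℝ) A‖

/-- The Euclidean norm of a vector. -/
def euclNorm {m : ℕ} (v : Fin m → ℝ) : ℝ :=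
  Real.sqrt (∑ j, v j ^ 2)

/-- The support `{(i, j) : A i j ≠ 0}` of a matrix. -/
def supp {ι κ : Type*} (A : Matrix ι κ ℝ) : Set (ι × κ) :=
  {p | A p.1 p.2 ≠ 0}

/-- The maximal number of non-zero entries in a column. -/
def maxColCount {ι κ : Type*} [Fintype ι] [Fintype κ] (A : Matrix ι κ ℝ) : ℕ :=
  Finset.univ.sup fun j : κ => {i : ι | A i j ≠ 0}.ncard

/-! ### The truncated normal distribution -/

/-- The unnormalized truncated normal measure: Lebesgue density
`exp (-(x - μ)ᵀ K (x - μ) / 2)` on the non-negative orthant. -/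
def truncNormalUnnorm {m : ℕ} (μ : Fin m → ℝ) (K : Matrix (Fin m) (Fin m) ℝ) :
    Measure (Fin m → ℝ) :=
  (volume.restrict {x : Fin m → ℝ | ∀ j, 0 ≤ x j}).withDensity fun x =>
    ENNReal.ofReal (Real.exp (-(1 / 2) * ((x - μ) ⬝ᵥ (K *ᵥ (x - μ)))))

/-- The truncated normal distribution `TN(μ, K)` with mean parameter `μ` and inverse covariance
parameter `K`. -/
def truncNormal {m : ℕ} (μ : Fin m → ℝ) (K : Matrix (Fin m) (Fin m) ℝ) :
    Measure (Fin m → ℝ) :=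
  (truncNormalUnnorm μ K univ)⁻¹ • truncNormalUnnorm μ K

/-- `c_X = 2 max_j (2 √((K⁻¹)_jj) + √e E X_j)` for `X ∼ TN(μ, K)`. -/
def cX {m : ℕ} (μ : Fin m → ℝ) (K : Matrix (Fin m) (Fin m) ℝ) : ℝ :=
  2 * ⨆ j, (2 * Real.sqrt (K⁻¹ j j) + Real.sqrt (Real.exp 1) * ∫ x, x j ∂(truncNormal μ K))

/-! ### The class of weight functions -/

/-- `|f|` is bounded a.e. on `(0, ∞)` by a piecewise power of `x`: there are finitely many break
points `T` such that on each piece (indexed by the number of break points passed) the bound is of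
the form `c * x ^ p`. -/
def BoundedByPiecewisePower (f : ℝ → ℝ) : Prop :=
  ∃ (T : Finset ℝ) (c p : ℕ → ℝ), ∀ᵐ x ∂(volume.restrict (Ioi (0 : ℝ))),
    |f x| ≤ c (T.filter (· ≤ x)).card * x ^ p (T.filter (· ≤ x)).card

/-- The class `H_{1,1}` of (componentwise) weight functions. Only the values of
the functions on `[0, ∞)` matter. -/
structure MemH11 {m : ℕ} (h : Fin m → ℝ → ℝ) : Prop where
  absCont : ∀ j, ∀ a b : ℝ, 0 ≤ a → a ≤ b → AbsolutelyContinuousOnInterval (h j) a b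
  pos : ∀ j, ∀ᵐ x ∂(volume.restrict (Ioi (0 : ℝ))), 0 < h j x
  bound : ∀ j, BoundedByPiecewisePower (h j)
  bound_deriv : ∀ j, BoundedByPiecewisePower (deriv (h j))
  tendsto_zero : ∀ j, Tendsto (h j) (𝓝[>] 0) (𝓝 0)

/-! ### The quadratic score matching loss for the parameter `Ψ`

The parameter `Ψ` is an `(m+1) × m` matrix with upper block `K` and last row `η`.
Its rows are indexed by `Fin m ⊕ Unit`. -/

/-- The parameter matrix with upper block `K` and last row `η`. -/
def mkPsi {m : ℕ} (K : Matrix (Fin m) (Fin m) ℝ) (η : Fin m → ℝ) :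
    Matrix (Fin m ⊕ Unit) (Fin m) ℝ :=
  Matrix.fromRows K (Matrix.replicateRow Unit η)

/-- The block `K` of `Ψ`. -/
def partK {m : ℕ} (Ψ : Matrix (Fin m ⊕ Unit) (Fin m) ℝ) : Matrix (Fin m) (Fin m) ℝ :=
  Matrix.of fun k j => Ψ (Sum.inl k) j

/-- The last row `η` of `Ψ`. -/
def partEta {m : ℕ} (Ψ : Matrix (Fin m ⊕ Unit) (Fin m) ℝ) : Fin m → ℝ :=
  fun j => Ψ (Sum.inr ()) j

/-- The `j`-th diagonal block of `Γ(x)`, where `x` is the `n × m` data matrix. -/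
def gammaBlock {n m : ℕ} (h : Fin m → ℝ → ℝ) (x : Matrix (Fin n) (Fin m) ℝ) (j : Fin m) :
    Matrix (Fin m ⊕ Unit) (Fin m ⊕ Unit) ℝ :=
  (n : ℝ)⁻¹ • Matrix.fromBlocks
    (xᵀ * Matrix.diagonal (fun i => h j (x i j)) * x)
    (-Matrix.replicateCol Unit (xᵀ *ᵥ fun i => h j (x i j)))
    (-Matrix.replicateRow Unit (xᵀ *ᵥ fun i => h j (x i j)))
    (Matrix.of fun _ _ => ∑ i, h j (x i j))

/-- The block-diagonal matrix `Γ(x)`, with rows and columns indexed by the entries of `Ψ`. -/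
def gammaMat {n m : ℕ} (h : Fin m → ℝ → ℝ) (x : Matrix (Fin n) (Fin m) ℝ) :
    Matrix ((Fin m ⊕ Unit) × Fin m) ((Fin m ⊕ Unit) × Fin m) ℝ :=
  Matrix.blockDiagonal (gammaBlock h x)

/-- The vector `g(x)`, indexed by the entries of `Ψ`. -/
def gVec {n m : ℕ} (h : Fin m → ℝ → ℝ) (x : Matrix (Fin n) (Fin m) ℝ) :
    (Fin m ⊕ Unit) × Fin m → ℝ
  | (Sum.inl k, j) => (n : ℝ)⁻¹ *
      ∑ i, (deriv (h j) (x i j) * x i k + if k = j then h j (x i j) else 0)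
  | (Sum.inr _, j) => -((n : ℝ)⁻¹ * ∑ i, deriv (h j) (x i j))

/-- The amplifier `γ`: `(δ - 1)` times the diagonal of `Γ(x)` on the entries of `K`, and zero on
the entries of `η`. -/
def amplifier {n m : ℕ} (h : Fin m → ℝ → ℝ) (δ : ℝ) (x : Matrix (Fin n) (Fin m) ℝ) :
    (Fin m ⊕ Unit) × Fin m → ℝ
  | (Sum.inl k, j) => (δ - 1) * gammaMat h x (Sum.inl k, j) (Sum.inl k, j)
  | (Sum.inr _, _) => 0

/-- The amplified matrix `Γ_γ(x) = Γ(x) + diag(γ)`. -/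
def gammaAmp {n m : ℕ} (h : Fin m → ℝ → ℝ) (δ : ℝ) (x : Matrix (Fin n) (Fin m) ℝ) :
    Matrix ((Fin m ⊕ Unit) × Fin m) ((Fin m ⊕ Unit) × Fin m) ℝ :=
  gammaMat h x + Matrix.diagonal (amplifier h δ x)

/-- The vectorization of `Ψ`. -/
def vecPsi {m : ℕ} (Ψ : Matrix (Fin m ⊕ Unit) (Fin m) ℝ) : (Fin m ⊕ Unit) × Fin m → ℝ :=
  fun p => Ψ p.1 p.2

/-- The `ℓ1`-regularized, amplified score matching loss. -/
def loss {n m : ℕ} (h : Fin m → ℝ → ℝ) (δ lam : ℝ) (x : Matrix (Fin n) (Fin m) ℝ)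
    (Ψ : Matrix (Fin m ⊕ Unit) (Fin m) ℝ) : ℝ :=
  1 / 2 * (vecPsi Ψ ⬝ᵥ (gammaAmp h δ x *ᵥ vecPsi Ψ)) - gVec h x ⬝ᵥ vecPsi Ψ
    + lam * ∑ i, ∑ j, |Ψ i j|

/-- `Ψ` is a regularized generalized score matching estimator: a global minimizer of the loss over
all (not necessarily symmetric) parameter matrices. -/
def IsEstimator {n m : ℕ} (h : Fin m → ℝ → ℝ) (δ lam : ℝ) (x : Matrix (Fin n) (Fin m) ℝ)
    (Ψ : Matrix (Fin m ⊕ Unit) (Fin m) ℝ) : Prop :=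
  ∀ Φ, loss h δ lam x Ψ ≤ loss h δ lam x Φ

/-! ### Population quantities -/

/-- The `n × m` data matrix whose rows are the observations `X i ω`. -/
def dataMat {Ω : Type*} {n m : ℕ} (X : Fin n → Ω → (Fin m → ℝ)) (ω : Ω) :
    Matrix (Fin n) (Fin m) ℝ :=
  Matrix.of fun i j => X i ω j

/-- `Γ₀ = E Γ(x)`, entrywise. -/
def gammaPop {Ω : Type*} [MeasurableSpace Ω] (P : Measure Ω) {n m : ℕ}
    (h : Fin m → ℝ → ℝ) (X : Fin n → Ω → (Fin m → ℝ)) :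
    Matrix ((Fin m ⊕ Unit) × Fin m) ((Fin m ⊕ Unit) × Fin m) ℝ :=
  Matrix.of fun a b => ∫ ω, gammaMat h (dataMat X ω) a b ∂P

/-- The submatrix of `A` with rows in `S` and columns in `T`. -/
def subMat {ι : Type*} (A : Matrix ι ι ℝ) (S T : Set ι) : Matrix S T ℝ :=
  A.submatrix Subtype.val Subtype.val

open Classical in
/-- `c_Γ`, the `ℓ∞`-`ℓ∞` operator norm of `(Γ_SS)⁻¹`. -/
def cGamma {ι : Type*} [Fintype ι] (A : Matrix ι ι ℝ) (S : Set ι) : ℝ :=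
  rowSumNorm (subMat A S S)⁻¹

open Classical in
/-- `A_SS` is invertible and `A` satisfies the irrepresentability condition with incoherence
parameter `α` and edge set `S`. -/
def Irrepresentable {ι : Type*} [Fintype ι] (A : Matrix ι ι ℝ) (S : Set ι) (α : ℝ) : Prop :=
  IsUnit (subMat A S S) ∧ rowSumNorm (subMat A Sᶜ S * (subMat A S S)⁻¹) ≤ 1 - α

/-- The upper bound `C(n, m)` on the multiplier. -/
def multBound (n m : ℕ) : ℝ :=
  2 - (1 + 4 * Real.exp 1 *
    max (6 * Real.log m / n) (Real.sqrt (6 * Real.log m / n)))⁻¹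

/-! ### The conclusion for a given data matrix -/

/-- The conclusion for one data matrix `x` and error level `B`. -/
structure GoodEstimate {n m : ℕ} (h : Fin m → ℝ → ℝ) (δ lam : ℝ) (x : Matrix (Fin n) (Fin m) ℝ)
    (K₀ : Matrix (Fin m) (Fin m) ℝ) (η₀ : Fin m → ℝ) (B : ℝ)
    (Ψ : Matrix (Fin m ⊕ Unit) (Fin m) ℝ) : Prop where
  minimizes : IsEstimator h δ lam x Ψ
  unique : ∀ Φ, IsEstimator h δ lam x Φ → Φ = Ψ
  supp_subset : supp Ψ ⊆ supp (mkPsi K₀ η₀)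
  max_K : ∀ k j, |(partK Ψ - K₀) k j| ≤ B
  max_eta : ∀ j, |(partEta Ψ - η₀) j| ≤ B
  frob_K : frobNorm (partK Ψ - K₀) ≤ B * Real.sqrt (supp (mkPsi K₀ η₀)).ncard
  frob_eta : euclNorm (partEta Ψ - η₀) ≤ B * Real.sqrt (supp (mkPsi K₀ η₀)).ncard
  spec_K : specNorm (partK Ψ - K₀) ≤
    B * min (Real.sqrt (supp (mkPsi K₀ η₀)).ncard) (maxColCount (mkPsi K₀ η₀))
  spec_eta : euclNorm (partEta Ψ - η₀) ≤ B * Real.sqrt {j | η₀ j ≠ 0}.ncard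
  sign_recovery : (∀ k j, K₀ k j ≠ 0 → B < |K₀ k j|) → (∀ j, η₀ j ≠ 0 → B < |η₀ j|) →
    supp Ψ = supp (mkPsi K₀ η₀) ∧
      (∀ k j, K₀ k j ≠ 0 → SignType.sign (partK Ψ k j) = SignType.sign (K₀ k j)) ∧
      (∀ j, η₀ j ≠ 0 → SignType.sign (partEta Ψ j) = SignType.sign (η₀ j))

end TruncGGM

end

/-! In `vec Ψ` the problem is a lasso with quadratic part `Γ_γ`, so the theorem follows from a
population identity, a deterministic error bound and a concentration bound.

Population. Along coordinate `j`, the product of `h_j(x_j)`, an entry of the extended observation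
`(x, -1)` and the density vanishes at `0`, because `h_j(0) = 0`, and integrates to zero after
differentiation. Since the log-density has `j`-th derivative `-(K₀(x - μ₀))_j`, this says `Γ₀ vec Ψ₀
= E g` (`integral_mul_score_eq`, `sum_integral_gammaTerm_mul_eq`).

Deterministic bound. Minimize the loss over matrices supported in `S₀`. The optimality conditions on
`S₀`, inverted through `Γ₀,SS`, bound the error there; irrepresentability then forces the gradient
off `S₀` to be at most `λ`, so the restricted minimizer is the global one
(`exists_minimizer_of_irrepresentable`). Uniqueness comes from positive definiteness of `Γ_γ`, which
`δ > 1` guarantees for every `n ≥ 1` (`posDef_gammaAmp`). Support, norm and sign statements follow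
by counting.

Concentration. Prékopa–Leindler on the orthant gives `E exp(tX_k) · E exp(-tX_k) ≤ exp(t²
(K₀⁻¹)_kk)`, and Jensen bounds the second factor below, so each coordinate is sub-Gaussian about its
mean. As `h` and `h'` are bounded, the summands of `Γ` and `g` are sub-exponential at scales `M c²`
and `M'c + M`, with `c = max 1 c_X`. Bernstein's inequality and a union bound make all entries
accurate to order `√T + T` with `T = τ log m / n`. The condition `δ < C(n, m)` keeps `δ - 1` of that
same order, so amplification costs only a constant. -/

section Auxiliary

open scoped Pointwise ENNReal

/-! ### The Prékopa–Leindler inequality in midpoint form -/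


/-- The one-dimensional Brunn–Minkowski inequality for compact sets. -/
theorem IsCompact.volume_add_le_volume_add {A B : Set ℝ} (hA : IsCompact A) (hB : IsCompact B)
    (hA₀ : A.Nonempty) (hB₀ : B.Nonempty) : volume A + volume B ≤ volume (A + B) := by
  obtain ⟨s, hs, hs'⟩ := hA.exists_isGreatest hA₀
  obtain ⟨t, ht, ht'⟩ := hB.exists_isLeast hB₀
  -- With `s = max A` and `t = min B`, the translates `A + t` and `s + B` both lie in `A + B` and
  -- meet at most in the point `s + t`.
  have h1 : (fun x => x + t) '' A ∪ (fun x => s + x) '' B ⊆ A + B := by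
    rintro _ (⟨x, hx, rfl⟩ | ⟨x, hx, rfl⟩)
    · exact Set.add_mem_add hx ht
    · exact Set.add_mem_add hs hx
  have hm : MeasurableSet ((fun x => s + x) '' B) :=
    (hB.image (by fun_prop)).measurableSet
  have hd : AEDisjoint volume ((fun x => x + t) '' A) ((fun x => s + x) '' B) := by
    refine measure_mono_null (t := {s + t}) ?_ (by simp)
    rintro _ ⟨⟨x, hx, rfl⟩, ⟨y, hy, hxy⟩⟩
    have h2 := hs' hx
    have h3 := ht' hy
    simp only [mem_singleton_iff]
    dsimp only at hxy
    linarith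
  calc volume A + volume B
      = volume ((fun x => x + t) '' A) + volume ((fun x => s + x) '' B) := by simp
    _ = volume ((fun x => x + t) '' A ∪ (fun x => s + x) '' B) :=
        (measure_union₀ hm.nullMeasurableSet hd).symm
    _ ≤ _ := measure_mono h1

/-- The one-dimensional Brunn–Minkowski inequality. -/
theorem MeasurableSet.volume_add_le_volume_add {A B : Set ℝ} (hA : MeasurableSet A)
    (hB : MeasurableSet B) (hA₀ : A.Nonempty) (hB₀ : B.Nonempty) :
    volume A + volume B ≤ volume (A + B) := by
  obtain ⟨a, ha⟩ := hA₀
  obtain ⟨b, hb⟩ := hB₀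
  rw [hA.measure_eq_iSup_isCompact, hB.measure_eq_iSup_isCompact]
  simp only [iSup_and']
  -- The approximating compact sets may be empty; adjoining `a` and `b` makes the compact case
  -- applicable.
  refine ENNReal.biSup_add_biSup_le' ⟨∅, by simp⟩ ⟨∅, by simp⟩ fun K hK L hL => ?_
  calc volume K + volume L ≤ volume (insert a K) + volume (insert b L) :=
        add_le_add (measure_mono (subset_insert _ _)) (measure_mono (subset_insert _ _))
    _ ≤ volume (insert a K + insert b L) :=
        (hK.2.insert a).volume_add_le_volume_add (hL.2.insert b) (insert_nonempty _ _)
          (insert_nonempty _ _)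
    _ ≤ volume (A + B) :=
        measure_mono (Set.add_subset_add (insert_subset ha hK.1) (insert_subset hb hL.1))

theorem ENNReal.four_mul_le_add_sq (x y : ℝ≥0∞) : 4 * (x * y) ≤ (x + y) ^ 2 := by
  induction x with
  | top => simp
  | coe x =>
    induction y with
    | top => simp
    | coe y =>
      norm_cast
      have := sq_nonneg ((x : ℝ) - y)
      rw [← NNReal.coe_le_coe]
      push_cast
      nlinarith

/-- The Prékopa–Leindler inequality on the line for normalized functions. -/
theorem lintegral_add_le_of_mul_le_sq {f g h : ℝ → ℝ} (hf : Measurable f) (hg : Measurable g)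
    (hh : Measurable h) (hf₀ : ∀ x, 0 ≤ f x) (hg₀ : ∀ x, 0 ≤ g x) (hh₀ : ∀ x, 0 ≤ h x)
    (hf₁ : IsLUB (range f) 1) (hg₁ : IsLUB (range g) 1)
    (H : ∀ x y, f x * g y ≤ h ((x + y) / 2) ^ 2) :
    (∫⁻ x, ENNReal.ofReal (f x)) + ∫⁻ x, ENNReal.ofReal (g x) ≤
      2 * ∫⁻ x, ENNReal.ofReal (h x) := by
  -- Layer cake formula; as the supremum is `1`, superlevel sets at heights `t ≥ 1` are empty.
  have layer : ∀ {u : ℝ → ℝ}, Measurable u → (∀ x, 0 ≤ u x) → IsLUB (range u) 1 →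
      ∫⁻ x, ENNReal.ofReal (u x) = ∫⁻ t in Ioo (0 : ℝ) 1, volume {x | t < u x} := by
    intro u hu hu₀ hu₁
    rw [lintegral_eq_lintegral_meas_lt volume (ae_of_all _ hu₀) hu.aemeasurable,
      ← Ioo_union_Ici_eq_Ioi zero_lt_one,
      lintegral_union measurableSet_Ici (by
        rw [Set.disjoint_left]; intro x hx hx'; exact absurd hx.2 (not_lt.2 hx'))]
    rw [setLIntegral_congr_fun (g := fun _ => 0) measurableSet_Ici]
    · simp
    · intro t ht
      have : {x | t < u x} = ∅ := by
        ext x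
        simp only [mem_ofPred_eq, mem_empty_iff_false, iff_false, not_lt]
        exact (hu₁.1 ⟨x, rfl⟩).trans ht
      simp [this]
  rw [layer hf hf₀ hf₁, layer hg hg₀ hg₁,
    lintegral_eq_lintegral_meas_lt volume (ae_of_all _ hh₀) hh.aemeasurable]
  calc _ ≤ ∫⁻ t in Ioo (0 : ℝ) 1, (volume {x | t < f x} + volume {x | t < g x}) :=
        le_lintegral_add _ _
    _ ≤ ∫⁻ t in Ioo (0 : ℝ) 1, 2 * volume {x | t < h x} := by
        refine setLIntegral_mono' measurableSet_Ioo fun t ht => ?_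
        -- This is where the normalization matters: for `t < 1` both superlevel sets are nonempty,
        -- as Brunn–Minkowski requires.
        obtain ⟨_, ⟨a, rfl⟩, ha⟩ := (lt_isLUB_iff hf₁).1 ht.2
        obtain ⟨_, ⟨b, rfl⟩, hb⟩ := (lt_isLUB_iff hg₁).1 ht.2
        refine (MeasurableSet.volume_add_le_volume_add (hf measurableSet_Ioi)
          (hg measurableSet_Ioi) ⟨a, ha⟩ ⟨b, hb⟩).trans ?_
        have hsub : f ⁻¹' Ioi t + g ⁻¹' Ioi t ⊆ (fun x => (2 : ℝ) * x) '' {x | t < h x} := by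
          rintro _ ⟨x, hx, y, hy, rfl⟩
          refine ⟨(x + y) / 2, ?_, by ring⟩
          have := H x y
          simp only [mem_preimage, mem_Ioi] at hx hy
          refine lt_of_pow_lt_pow_left₀ 2 (hh₀ _) (lt_of_lt_of_le ?_ this)
          nlinarith [ht.1]
        refine (measure_mono hsub).trans ?_
        have := Measure.addHaar_smul (volume : Measure ℝ) 2 {x | t < h x}
        simp only [← image_smul, smul_eq_mul, Module.finrank_self, pow_one] at this
        rw [this]
        simp
    _ = 2 * ∫⁻ t in Ioo (0 : ℝ) 1, volume {x | t < h x} := lintegral_const_mul' _ _ (by simp)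
    _ ≤ _ := by gcongr; exact Ioo_subset_Ioi_self

/-- The Prékopa–Leindler inequality on the line for bounded functions. -/
theorem lintegral_mul_le_sq_of_bounded {f g h : ℝ → ℝ} (hf : Measurable f) (hg : Measurable g)
    (hh : Measurable h) (hf₀ : ∀ x, 0 ≤ f x) (hg₀ : ∀ x, 0 ≤ g x) (hh₀ : ∀ x, 0 ≤ h x)
    {N : ℝ} (hf₁ : ∀ x, f x ≤ N) (hg₁ : ∀ x, g x ≤ N)
    (H : ∀ x y, f x * g y ≤ h ((x + y) / 2) ^ 2) :
    (∫⁻ x, ENNReal.ofReal (f x)) * ∫⁻ x, ENNReal.ofReal (g x) ≤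
      (∫⁻ x, ENNReal.ofReal (h x)) ^ 2 := by
  have key : ∀ {u : ℝ → ℝ}, (∀ x, 0 ≤ u x) → (∀ x, u x ≤ N) → (∃ x, u x ≠ 0) →
      ∃ a, 0 < a ∧ IsLUB (range fun x => a⁻¹ * u x) 1 := by
    rintro u hu₀ hu₁ ⟨x, hx⟩
    have hlub : IsLUB (range u) (⨆ x, u x) :=
      isLUB_ciSup ⟨N, by rintro _ ⟨y, rfl⟩; exact hu₁ y⟩
    have ha : 0 < ⨆ x, u x := lt_of_lt_of_le ((hu₀ x).lt_of_ne' hx) (hlub.1 ⟨x, rfl⟩)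
    refine ⟨_, ha, ?_⟩
    have := hlub.mul_left (inv_nonneg.2 ha.le)
    rwa [inv_mul_cancel₀ ha.ne', ← range_comp] at this
  by_cases hfz : ∃ x, f x ≠ 0
  swap
  · push Not at hfz; simp [hfz]
  by_cases hgz : ∃ x, g x ≠ 0
  swap
  · push Not at hgz; simp [hgz]
  obtain ⟨a, ha, hfa⟩ := key hf₀ hf₁ hfz
  obtain ⟨b, hb, hgb⟩ := key hg₀ hg₁ hgz
  -- Dividing `f`, `g` by their suprema `a`, `b` and `h` by `√(ab)` preserves the hypothesis and
  -- normalizes both suprema to `1`.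
  set c := Real.sqrt (a * b) with hc
  have hc0 : 0 < c := Real.sqrt_pos.2 (mul_pos ha hb)
  have hcc : c ^ 2 = a * b := Real.sq_sqrt (mul_pos ha hb).le
  have scale : ∀ {u : ℝ → ℝ} {r : ℝ}, 0 < r → ∫⁻ x, ENNReal.ofReal (u x) =
      ENNReal.ofReal r * ∫⁻ x, ENNReal.ofReal (r⁻¹ * u x) := by
    intro u r hr
    rw [← lintegral_const_mul' _ _ ENNReal.ofReal_ne_top]
    refine lintegral_congr fun x => ?_
    rw [← ENNReal.ofReal_mul hr.le, mul_inv_cancel_left₀ hr.ne']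
  have h1 := lintegral_add_le_of_mul_le_sq (hf.const_mul a⁻¹) (hg.const_mul b⁻¹)
    (hh.const_mul c⁻¹) (fun x => mul_nonneg (inv_nonneg.2 ha.le) (hf₀ x))
    (fun x => mul_nonneg (inv_nonneg.2 hb.le) (hg₀ x))
    (fun x => mul_nonneg (inv_nonneg.2 hc0.le) (hh₀ x)) hfa hgb (fun x y => by
      have := H x y
      calc a⁻¹ * f x * (b⁻¹ * g y) = (a * b)⁻¹ * (f x * g y) := by field_simp
        _ ≤ (a * b)⁻¹ * h ((x + y) / 2) ^ 2 := by gcongr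
        _ = _ := by rw [mul_pow, inv_pow, hcc])
  rw [scale ha (u := f), scale hb (u := g), scale hc0 (u := h)]
  set F := ∫⁻ x, ENNReal.ofReal (a⁻¹ * f x)
  set G := ∫⁻ x, ENNReal.ofReal (b⁻¹ * g x)
  set I := ∫⁻ x, ENNReal.ofReal (c⁻¹ * h x)
  have h2 : F * G ≤ I ^ 2 := by
    have h3 : 4 * (F * G) ≤ 4 * I ^ 2 := by
      refine (ENNReal.four_mul_le_add_sq F G).trans ((pow_le_pow_left' h1 2).trans_eq ?_)
      rw [mul_pow]; norm_num
    exact (ENNReal.mul_le_mul_iff_right (by norm_num) (by norm_num)).1 h3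
  calc ENNReal.ofReal a * F * (ENNReal.ofReal b * G)
      = ENNReal.ofReal (c ^ 2) * (F * G) := by
        rw [hcc, ENNReal.ofReal_mul ha.le]; ring
    _ ≤ ENNReal.ofReal (c ^ 2) * I ^ 2 := by gcongr
    _ = _ := by rw [mul_pow, ENNReal.ofReal_pow hc0.le]

/-- The Prékopa–Leindler inequality on the line, in midpoint form. -/
theorem lintegral_mul_le_sq_real {f g h : ℝ → ℝ≥0∞} (hf : Measurable f) (hg : Measurable g)
    (hh : Measurable h) (H : ∀ x y, f x * g y ≤ h ((x + y) / 2) ^ 2) :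
    (∫⁻ x, f x) * ∫⁻ x, g x ≤ (∫⁻ x, h x) ^ 2 := by
  have trunc : ∀ {u : ℝ → ℝ≥0∞}, Measurable u →
      ∫⁻ x, u x = ⨆ N : ℕ, ∫⁻ x, min (u x) N := by
    intro u hu
    rw [← lintegral_iSup (fun N => hu.min measurable_const)]
    · refine lintegral_congr fun x => ?_
      rw [← inf_iSup_eq, ENNReal.iSup_natCast, inf_top_eq]
    · intro N N' hN x
      exact min_le_min_left _ (by exact_mod_cast hN)
  have hmono : ∀ u : ℝ → ℝ≥0∞, Monotone fun N : ℕ => ∫⁻ x, min (u x) N := fun u N N' hN =>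
    lintegral_mono fun x => min_le_min_left _ (by exact_mod_cast hN)
  rw [trunc hf, trunc hg, ENNReal.iSup_mul]
  simp only [ENNReal.mul_iSup]
  refine iSup₂_le fun N₁ N₂ => ?_
  obtain ⟨N, hN₁, hN₂⟩ : ∃ N, N₁ ≤ N ∧ N₂ ≤ N := ⟨_, le_max_left _ _, le_max_right _ _⟩
  refine (mul_le_mul' (hmono f hN₁) (hmono g hN₂)).trans ?_
  beta_reduce
  have hfin : ∀ (u : ℝ → ℝ≥0∞) x, min (u x) N ≠ ∞ := fun u x =>
    ((min_le_right _ _).trans_lt (ENNReal.natCast_lt_top N)).ne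
  have conv : ∀ u : ℝ → ℝ≥0∞, ∫⁻ x, min (u x) N =
      ∫⁻ x, ENNReal.ofReal (min (u x) N).toReal := fun u =>
    lintegral_congr fun x => (ENNReal.ofReal_toReal (hfin u x)).symm
  have hle : ∀ (u : ℝ → ℝ≥0∞) x, (min (u x) N).toReal ≤ N := fun u x =>
    ENNReal.toReal_le_of_le_ofReal (by positivity) (by simp)
  have hmeas : ∀ {u : ℝ → ℝ≥0∞}, Measurable u → Measurable fun x => (min (u x) N).toReal :=
    fun hu => (hu.min measurable_const).ennreal_toReal
  -- Cutting all three functions at the same level `N` preserves the hypothesis: where `h > N`, the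
  -- truncated product is at most `N²`.
  have hmain := lintegral_mul_le_sq_of_bounded (hmeas hf) (hmeas hg) (hmeas hh)
    (fun _ => ENNReal.toReal_nonneg) (fun _ => ENNReal.toReal_nonneg)
    (fun _ => ENNReal.toReal_nonneg) (hle f) (hle g) (fun x y => by
      rw [← ENNReal.toReal_mul, ← ENNReal.toReal_pow]
      refine ENNReal.toReal_mono (ENNReal.pow_ne_top (hfin h _)) ?_
      rcases le_total (h ((x + y) / 2)) N with hN | hN
      · rw [min_eq_left hN]
        exact (mul_le_mul' (min_le_left _ _) (min_le_left _ _)).trans (H x y)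
      · rw [min_eq_right hN, sq]
        exact mul_le_mul' (min_le_right _ _) (min_le_right _ _))
  rw [← conv, ← conv, ← conv] at hmain
  refine hmain.trans ?_
  gcongr
  exact min_le_left _ _

/-- The Prékopa–Leindler inequality in `ℝᵐ`, in midpoint form. -/
theorem lintegral_mul_le_sq_pi {m : ℕ} {f g h : (Fin m → ℝ) → ℝ≥0∞} (hf : Measurable f)
    (hg : Measurable g) (hh : Measurable h)
    (H : ∀ x y, f x * g y ≤ h ((2 : ℝ)⁻¹ • (x + y)) ^ 2) :
    (∫⁻ x, f x) * ∫⁻ x, g x ≤ (∫⁻ x, h x) ^ 2 := by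
  induction m with
  | zero =>
    have := H default default
    rw [lintegral_unique, lintegral_unique, lintegral_unique]
    simp only [volume_pi, Measure.pi_of_empty (fun _ : Fin 0 => (volume : Measure ℝ)) default,
      Measure.dirac_apply_of_mem (mem_univ _), mul_one]
    convert this
  | succ m ih =>
    let e := (MeasurableEquiv.piFinSuccAbove (fun _ : Fin (m + 1) => ℝ) 0).symm
    have he : MeasurePreserving e := (volume_preserving_piFinSuccAbove (fun _ => ℝ) 0).symm _
    have fub : ∀ {u : (Fin (m + 1) → ℝ) → ℝ≥0∞}, Measurable u →
        ∫⁻ x, u x = ∫⁻ s, ∫⁻ y, u (e (s, y)) := by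
      intro u hu
      rw [← he.lintegral_comp hu, Measure.volume_eq_prod,
        lintegral_prod (fun z => u (e z)) (hu.comp e.measurable).aemeasurable]
    have hmid : ∀ s t y z, (2 : ℝ)⁻¹ • (e (s, y) + e (t, z)) =
        e ((s + t) / 2, (2 : ℝ)⁻¹ • (y + z)) := by
      intro s t y z
      ext i
      refine Fin.cases ?_ (fun i => ?_) i
      · simp [e, MeasurableEquiv.piFinSuccAbove_symm_apply]; ring
      · simp [e, MeasurableEquiv.piFinSuccAbove_symm_apply]; ring
    rw [fub hf, fub hg, fub hh]
    -- Tensorization: the induction hypothesis on the fibres is exactly the hypothesis of the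
    -- one-dimensional inequality for the fibre integrals.
    refine lintegral_mul_le_sq_real ((hf.comp e.measurable).lintegral_prod_right')
      ((hg.comp e.measurable).lintegral_prod_right')
      ((hh.comp e.measurable).lintegral_prod_right') fun s t => ?_
    refine ih (hf.comp (e.measurable.comp measurable_prodMk_left))
      (hg.comp (e.measurable.comp measurable_prodMk_left))
      (hh.comp (e.measurable.comp measurable_prodMk_left)) fun y z => ?_
    have := H (e (s, y)) (e (t, z))
    rwa [hmid] at this

/-! ### Exponential moments of the truncated normal distribution -/

namespace TruncGGM

/-- The unnormalized density of the truncated normal distribution. -/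
noncomputable def truncDensity {m : ℕ} (μ : Fin m → ℝ) (K : Matrix (Fin m) (Fin m) ℝ)
    (x : Fin m → ℝ) : ℝ :=
  Real.exp (-(1 / 2) * ((x - μ) ⬝ᵥ (K *ᵥ (x - μ))))

theorem continuous_truncDensity {m : ℕ} (μ : Fin m → ℝ) (K : Matrix (Fin m) (Fin m) ℝ) :
    Continuous (truncDensity μ K) := by
  unfold truncDensity
  fun_prop

theorem truncDensity_pos {m : ℕ} (μ : Fin m → ℝ) (K : Matrix (Fin m) (Fin m) ℝ) (x : Fin m → ℝ) :
    0 < truncDensity μ K x :=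
  Real.exp_pos _

theorem truncNormalUnnorm_eq {m : ℕ} (μ : Fin m → ℝ) (K : Matrix (Fin m) (Fin m) ℝ) :
    truncNormalUnnorm μ K = (volume.restrict {x : Fin m → ℝ | ∀ j, 0 ≤ x j}).withDensity
      fun x => ENNReal.ofReal (truncDensity μ K x) :=
  rfl

theorem measurableSet_orthant (m : ℕ) : MeasurableSet {x : Fin m → ℝ | ∀ j, 0 ≤ x j} := by
  have : {x : Fin m → ℝ | ∀ j, 0 ≤ x j} = ⋂ j, {x | 0 ≤ x j} := by ext; simp
  rw [this]
  exact MeasurableSet.iInter fun j => measurableSet_le measurable_const (measurable_pi_apply j)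

theorem lintegral_truncNormal {m : ℕ} (μ : Fin m → ℝ) (K : Matrix (Fin m) (Fin m) ℝ)
    {u : (Fin m → ℝ) → ℝ≥0∞} (hu : Measurable u) :
    ∫⁻ x, u x ∂(truncNormal μ K) = (truncNormalUnnorm μ K univ)⁻¹ *
      ∫⁻ x, {x : Fin m → ℝ | ∀ j, 0 ≤ x j}.indicator
        (fun x => ENNReal.ofReal (truncDensity μ K x)) x * u x := by
  have hp := (continuous_truncDensity μ K).measurable.ennreal_ofReal
  rw [truncNormal, lintegral_smul_measure, truncNormalUnnorm_eq,
    lintegral_withDensity_eq_lintegral_mul _ hp hu, ← lintegral_indicator (measurableSet_orthant m)]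
  simp only [smul_eq_mul]
  congr 1
  refine lintegral_congr fun x => ?_
  by_cases hx : x ∈ {x : Fin m → ℝ | ∀ j, 0 ≤ x j}
  · simp [indicator_of_mem hx]
  · simp [indicator_of_notMem hx]

theorem truncNormalUnnorm_univ_ne {m : ℕ} (μ : Fin m → ℝ) (K : Matrix (Fin m) (Fin m) ℝ)
    [IsProbabilityMeasure (truncNormal μ K)] :
    truncNormalUnnorm μ K univ ≠ 0 ∧ truncNormalUnnorm μ K univ ≠ ∞ := by
  have h : truncNormal μ K univ = 1 := measure_univ
  rw [truncNormal, Measure.smul_apply, smul_eq_mul] at h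
  constructor
  · intro h0; simp [h0] at h
  · intro h0; simp [h0] at h

theorem truncNormalUnnorm_univ {m : ℕ} (μ : Fin m → ℝ) (K : Matrix (Fin m) (Fin m) ℝ) :
    truncNormalUnnorm μ K univ = ∫⁻ x, {x : Fin m → ℝ | ∀ j, 0 ≤ x j}.indicator
        (fun x => ENNReal.ofReal (truncDensity μ K x)) x := by
  rw [truncNormalUnnorm, withDensity_apply _ MeasurableSet.univ, Measure.restrict_univ,
    lintegral_indicator (measurableSet_orthant m)]
  rfl

theorem ae_truncNormal_of_ae_volume {m : ℕ} {μ : Fin m → ℝ} {K : Matrix (Fin m) (Fin m) ℝ}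
    {p : (Fin m → ℝ) → Prop}
    (h : ∀ᵐ x ∂(volume.restrict {x : Fin m → ℝ | ∀ j, 0 ≤ x j}), p x) :
    ∀ᵐ x ∂(truncNormal μ K), p x :=
  Measure.smul_absolutelyContinuous ((withDensity_absolutelyContinuous _ _) h)

theorem truncNormal_absolutelyContinuous {m : ℕ} (μ : Fin m → ℝ) (K : Matrix (Fin m) (Fin m) ℝ) :
    truncNormal μ K ≪ volume.restrict {x : Fin m → ℝ | ∀ j, 0 ≤ x j} :=
  Measure.smul_absolutelyContinuous.trans (withDensity_absolutelyContinuous _ _)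

theorem ae_pos_truncNormal {m : ℕ} (μ : Fin m → ℝ) (K : Matrix (Fin m) (Fin m) ℝ) :
    ∀ᵐ x ∂(truncNormal μ K), ∀ j, 0 < x j := by
  refine ae_truncNormal_of_ae_volume ?_
  rw [ae_restrict_iff' (measurableSet_orthant m)]
  have h : ∀ j : Fin m, ∀ᵐ x : Fin m → ℝ, x j ≠ 0 := fun j =>
    (Measure.quasiMeasurePreserving_eval (fun _ : Fin m => (volume : Measure ℝ)) j).ae
      (Measure.ae_ne volume 0)
  filter_upwards [ae_all_iff.2 h] with x hx hx' j
  exact (hx' j).lt_of_ne' (hx j)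

/-- An almost sure property on the half line holds almost surely for a coordinate. -/
theorem ae_eval_truncNormal {m : ℕ} (μ : Fin m → ℝ) (K : Matrix (Fin m) (Fin m) ℝ)
    {p : ℝ → Prop} (hp : ∀ᵐ s ∂(volume.restrict (Ioi (0 : ℝ))), p s) (j : Fin m) :
    ∀ᵐ x ∂(truncNormal μ K), p (x j) := by
  have h1 : ∀ᵐ x ∂(truncNormal μ K), x j ∈ Ioi (0 : ℝ) → p (x j) := by
    refine ae_truncNormal_of_ae_volume (ae_restrict_of_ae ?_)
    exact (Measure.quasiMeasurePreserving_eval (fun _ : Fin m => (volume : Measure ℝ)) j).ae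
      ((ae_restrict_iff' measurableSet_Ioi).1 hp)
  filter_upwards [h1, ae_pos_truncNormal μ K] with x hx hx'
  exact hx (hx' j)

theorem dotProduct_mulVec_comm_of_isHermitian {m : ℕ} {K : Matrix (Fin m) (Fin m) ℝ}
    (hK : K.IsHermitian) (x y : Fin m → ℝ) : x ⬝ᵥ (K *ᵥ y) = y ⬝ᵥ (K *ᵥ x) := by
  have h : Kᵀ = K := by simpa using hK.eq
  rw [dotProduct_mulVec, ← mulVec_transpose, h, dotProduct_comm]

/-- Completing the square: the form `K` is non-negative at `v - 2t K⁻¹ e_k`. -/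
theorem mul_sub_quarter_quadForm_le {m : ℕ} {K : Matrix (Fin m) (Fin m) ℝ} (hK : K.PosDef)
    (v : Fin m → ℝ) (t : ℝ) (k : Fin m) :
    t * v k - 1 / 4 * (v ⬝ᵥ (K *ᵥ v)) ≤ t ^ 2 * K⁻¹ k k := by
  set e : Fin m → ℝ := Pi.single k 1
  have hdet : IsUnit K.det := (isUnit_iff_isUnit_det _).1 hK.isUnit
  have h1 : K *ᵥ (K⁻¹ *ᵥ e) = e := by rw [mulVec_mulVec, mul_nonsing_inv _ hdet, one_mulVec]
  have h2 : ∀ u : Fin m → ℝ, u ⬝ᵥ e = u k := fun u => by simp [e]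
  have h3 : (K⁻¹ *ᵥ e) k = K⁻¹ k k := by simp [e]
  have h := hK.posSemidef.dotProduct_mulVec_nonneg (v - (2 * t) • (K⁻¹ *ᵥ e))
  simp only [star_trivial] at h
  have h4 := dotProduct_mulVec_comm_of_isHermitian hK.1 (K⁻¹ *ᵥ e) v
  rw [h1, h2] at h4
  rw [mulVec_sub, mulVec_smul, h1, sub_dotProduct, dotProduct_sub, dotProduct_sub,
    smul_dotProduct, smul_dotProduct, dotProduct_smul, dotProduct_smul, h2, h2, h3, h4] at h
  simp only [smul_eq_mul] at h
  nlinarith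

/-- By the parallelogram identity, the two densities multiply to the squared density at the midpoint
times `exp(-q(x - y) / 4)`, where `q` is the form of `K`. That Gaussian gain absorbs the tilt `t
(x_k - y_k)`, up to `exp(t² (K⁻¹)_kk)`. -/
theorem truncDensity_mul_le {m : ℕ} (μ : Fin m → ℝ) {K : Matrix (Fin m) (Fin m) ℝ}
    (hK : K.PosDef) (t : ℝ) (k : Fin m) (x y : Fin m → ℝ) :
    (truncDensity μ K x * Real.exp (t * x k)) * (truncDensity μ K y * Real.exp (-t * y k)) ≤
      (truncDensity μ K ((2 : ℝ)⁻¹ • (x + y)) * Real.exp (t ^ 2 * K⁻¹ k k / 2)) ^ 2 := by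
  unfold truncDensity
  rw [← Real.exp_add, ← Real.exp_add, ← Real.exp_add, ← Real.exp_add, ← Real.exp_nat_mul]
  refine Real.exp_le_exp.2 ?_
  set u := x - μ
  set w := y - μ
  have h1 : (2 : ℝ)⁻¹ • (x + y) - μ = (2 : ℝ)⁻¹ • (u + w) := by
    ext i; simp [u, w]; ring
  have h2 := mul_sub_quarter_quadForm_le hK (u - w) t k
  have h3 : (u - w) k = x k - y k := by simp [u, w]
  have h4 := dotProduct_mulVec_comm_of_isHermitian hK.1 u w
  rw [h3] at h2
  rw [h1]
  rw [mulVec_sub, sub_dotProduct, dotProduct_sub, dotProduct_sub, h4] at h2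
  rw [mulVec_smul, smul_dotProduct, dotProduct_smul, mulVec_add, add_dotProduct, dotProduct_add,
    dotProduct_add, h4]
  simp only [smul_eq_mul]
  push_cast
  nlinarith

/-- Prékopa–Leindler for the density tilted by `t` and by `-t`; convexity of the orthant keeps
midpoints inside it. Working with `∫⁻` avoids assuming finite exponential moments. -/
theorem lintegral_exp_mul_lintegral_exp_le {m : ℕ} (μ : Fin m → ℝ) {K : Matrix (Fin m) (Fin m) ℝ}
    (hK : K.PosDef) [IsProbabilityMeasure (truncNormal μ K)] (t : ℝ) (k : Fin m) :
    (∫⁻ x, ENNReal.ofReal (Real.exp (t * x k)) ∂(truncNormal μ K)) *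
      ∫⁻ x, ENNReal.ofReal (Real.exp (-t * x k)) ∂(truncNormal μ K) ≤
        ENNReal.ofReal (Real.exp (t ^ 2 * K⁻¹ k k)) := by
  obtain ⟨hZ0, hZ⟩ := truncNormalUnnorm_univ_ne μ K
  have hexp : ∀ s : ℝ, Measurable fun x : Fin m → ℝ => ENNReal.ofReal (Real.exp (s * x k)) :=
    fun s => by fun_prop
  rw [lintegral_truncNormal μ K (hexp t), lintegral_truncNormal μ K (hexp (-t))]
  set O := {x : Fin m → ℝ | ∀ j, 0 ≤ x j} with hO
  have hp : Measurable (O.indicator fun x => ENNReal.ofReal (truncDensity μ K x)) :=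
    (continuous_truncDensity μ K).measurable.ennreal_ofReal.indicator (measurableSet_orthant m)
  have key := lintegral_mul_le_sq_pi (hp.mul (hexp t)) (hp.mul (hexp (-t)))
    (hp.mul_const (ENNReal.ofReal (Real.exp (t ^ 2 * K⁻¹ k k / 2)))) (fun x y => by
      simp only [Pi.mul_apply]
      by_cases hx : x ∈ O
      swap
      · simp [indicator_of_notMem hx]
      by_cases hy : y ∈ O
      swap
      · simp [indicator_of_notMem hy]
      have hxy : (2 : ℝ)⁻¹ • (x + y) ∈ O := fun j => by
        have := hx j; have := hy j
        simp only [Pi.smul_apply, Pi.add_apply, smul_eq_mul]; positivity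
      rw [indicator_of_mem hx, indicator_of_mem hy, indicator_of_mem hxy,
        ← ENNReal.ofReal_mul (truncDensity_pos μ K _).le,
        ← ENNReal.ofReal_mul (truncDensity_pos μ K _).le,
        ← ENNReal.ofReal_mul (truncDensity_pos μ K _).le,
        ← ENNReal.ofReal_mul (mul_pos (truncDensity_pos μ K _) (Real.exp_pos _)).le,
        ← ENNReal.ofReal_pow (mul_pos (truncDensity_pos μ K _) (Real.exp_pos _)).le]
      exact ENNReal.ofReal_le_ofReal (truncDensity_mul_le μ hK t k x y))
  simp only [Pi.mul_apply] at key
  rw [lintegral_mul_const _ hp, ← truncNormalUnnorm_univ] at key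
  set Z := truncNormalUnnorm μ K univ
  calc _ = Z⁻¹ ^ 2 * _ := by rw [sq, mul_mul_mul_comm]
    _ ≤ Z⁻¹ ^ 2 * (Z * ENNReal.ofReal (Real.exp (t ^ 2 * K⁻¹ k k / 2))) ^ 2 := by gcongr
    _ = (Z⁻¹ * Z) ^ 2 * ENNReal.ofReal (Real.exp (t ^ 2 * K⁻¹ k k / 2)) ^ 2 := by ring
    _ = _ := by
      rw [ENNReal.inv_mul_cancel hZ0 hZ, one_pow, one_mul,
        ← ENNReal.ofReal_pow (Real.exp_pos _).le, ← Real.exp_nat_mul]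
      congr 2; push_cast; ring

/-- The product of the moments at `t` and `-t` is finite and the second factor is non-zero, so the
first cannot be infinite. -/
theorem integrable_exp_mul_truncNormal {m : ℕ} (μ : Fin m → ℝ) {K : Matrix (Fin m) (Fin m) ℝ}
    (hK : K.PosDef) [IsProbabilityMeasure (truncNormal μ K)] (t : ℝ) (k : Fin m) :
    Integrable (fun x => Real.exp (t * x k)) (truncNormal μ K) := by
  have h := lintegral_exp_mul_lintegral_exp_le μ hK t k
  refine ⟨(by fun_prop : Measurable _).aestronglyMeasurable, ?_⟩
  rw [hasFiniteIntegral_iff_ofReal (ae_of_all _ fun x => (Real.exp_pos _).le)]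
  refine lt_of_le_of_ne le_top fun htop => ?_
  rw [htop, ENNReal.top_mul] at h
  · exact absurd h (by simp)
  · intro h0
    rw [lintegral_eq_zero_iff (by fun_prop)] at h0
    have : ∀ᵐ x ∂(truncNormal μ K), False := by
      filter_upwards [h0] with x hx
      simp only [Pi.zero_apply, ENNReal.ofReal_eq_zero] at hx
      exact absurd hx (not_le.2 (Real.exp_pos _))
    simp at this
    exact IsProbabilityMeasure.ne_zero _ this

theorem integrable_eval_truncNormal {m : ℕ} (μ : Fin m → ℝ) {K : Matrix (Fin m) (Fin m) ℝ}
    (hK : K.PosDef) [IsProbabilityMeasure (truncNormal μ K)] (k : Fin m) :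
    Integrable (fun x => x k) (truncNormal μ K) := by
  refine (integrable_exp_mul_truncNormal μ hK 1 k).mono'
    (measurable_pi_apply k).aestronglyMeasurable ?_
  filter_upwards [ae_pos_truncNormal μ K] with x hx
  rw [Real.norm_of_nonneg (hx k).le, one_mul]
  linarith [Real.add_one_le_exp (x k)]

theorem integral_exp_mul_le {m : ℕ} (μ : Fin m → ℝ) {K : Matrix (Fin m) (Fin m) ℝ}
    (hK : K.PosDef) [IsProbabilityMeasure (truncNormal μ K)] (t : ℝ) (k : Fin m) :
    ∫ x, Real.exp (t * x k) ∂(truncNormal μ K) ≤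
      Real.exp (t ^ 2 * K⁻¹ k k + t * ∫ x, x k ∂(truncNormal μ K)) := by
  set E := ∫ x, x k ∂(truncNormal μ K)
  have h := lintegral_exp_mul_lintegral_exp_le μ hK t k
  rw [← ofReal_integral_eq_lintegral_ofReal (integrable_exp_mul_truncNormal μ hK t k)
      (ae_of_all _ fun x => (Real.exp_pos _).le),
    ← ofReal_integral_eq_lintegral_ofReal (integrable_exp_mul_truncNormal μ hK (-t) k)
      (ae_of_all _ fun x => (Real.exp_pos _).le), ← ENNReal.ofReal_mul
      (integral_nonneg fun x => (Real.exp_pos _).le),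
    ENNReal.ofReal_le_ofReal_iff (Real.exp_pos _).le] at h
  have hint := integrable_eval_truncNormal μ hK k
  have hlin : Integrable (fun x => x k - E) (truncNormal μ K) := hint.sub (integrable_const _)
  -- Jensen's inequality, through the tangent line of the exponential at the mean.
  have h2 : Real.exp (-t * E) ≤ ∫ x, Real.exp (-t * x k) ∂(truncNormal μ K) := by
    have h3 : ∫ x, (Real.exp (-t * E) * (1 + -t * (x k - E))) ∂(truncNormal μ K) =
        Real.exp (-t * E) := by
      rw [integral_const_mul, integral_add (integrable_const _) (hlin.const_mul _),
        integral_const_mul, integral_sub hint (integrable_const _)]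
      simp [E]
    rw [← h3]
    refine integral_mono ?_ (integrable_exp_mul_truncNormal μ hK (-t) k) fun x => ?_
    · exact ((integrable_const _).add (hlin.const_mul _)).const_mul _
    · calc Real.exp (-t * E) * (1 + -t * (x k - E))
          ≤ Real.exp (-t * E) * Real.exp (-t * (x k - E)) := by
            gcongr; linarith [Real.add_one_le_exp (-t * (x k - E))]
        _ = _ := by rw [← Real.exp_add]; congr 1; ring
  have h4 : (∫ x, Real.exp (t * x k) ∂(truncNormal μ K)) * Real.exp (-t * E) ≤
      Real.exp (t ^ 2 * K⁻¹ k k) :=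
    (mul_le_mul_of_nonneg_left h2 (integral_nonneg fun x => (Real.exp_pos _).le)).trans h
  rw [Real.exp_add]
  calc _ = (∫ x, Real.exp (t * x k) ∂(truncNormal μ K)) * Real.exp (-t * E) * Real.exp (t * E) := by
        rw [mul_assoc, ← Real.exp_add]; simp
    _ ≤ _ := by gcongr

end TruncGGM

/-- A non-negative random variable with a sub-Gaussian moment generating function has an
integrable exponential square. -/
theorem lintegral_exp_sq_le_two {α : Type*} [MeasurableSpace α] {ν : Measure α}
    [IsProbabilityMeasure ν] {Z : α → ℝ}
    (hZ : AEMeasurable Z ν) (hZ₀ : ∀ᵐ x ∂ν, 0 ≤ Z x) {a : ℝ} (ha : 0 < a)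
    (hmgf : ∀ t, 0 ≤ t → ∫⁻ x, ENNReal.ofReal (Real.exp (t * Z x)) ∂ν ≤
      ENNReal.ofReal (Real.exp (t ^ 2 * a ^ 2 + t * a))) :
    ∫⁻ x, ENNReal.ofReal (Real.exp (Z x ^ 2 / (4 * Real.exp 2 * a ^ 2))) ∂ν ≤ 2 := by
  set c := 4 * Real.exp 2 * a ^ 2 with hc
  have hc0 : 0 < c := by positivity
  have hexp : ∀ x, ENNReal.ofReal (Real.exp (Z x ^ 2 / c)) =
      ∑' p : ℕ, ENNReal.ofReal ((Z x ^ 2 / c) ^ p / p.factorial) := by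
    intro x
    rw [Real.exp_eq_exp_ℝ, NormedSpace.exp_eq_tsum_div,
      ENNReal.ofReal_tsum_of_nonneg (fun p => by positivity)
        (Real.summable_pow_div_factorial _)]
  have hterm : ∀ p : ℕ, ∫⁻ x, ENNReal.ofReal ((Z x ^ 2 / c) ^ p / p.factorial) ∂ν ≤ (2⁻¹ : ℝ≥0∞) ^ p := by
    intro p
    -- The `p`-th Taylor term is controlled by the moment at `t = √p / a`, which is at most `exp(p +
    -- √p) ≤ exp(2p)`. With `(2p)! ≤ (2p)^p p!`, the constant `4e²a²` leaves exactly `2^(-p)` per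
    -- term, hence the sum `2`.
    set t := Real.sqrt p / a with ht
    have ht0 : 0 ≤ t := by positivity
    have hta : t * a = Real.sqrt p := by rw [ht, div_mul_cancel₀ _ ha.ne']
    have hta2 : t ^ 2 * a ^ 2 = p := by rw [← mul_pow, hta, Real.sq_sqrt (Nat.cast_nonneg p)]
    have hsq : Real.sqrt p ≤ p := by
      rcases Nat.eq_zero_or_pos p with rfl | hp
      · simp
      · rw [Real.sqrt_le_left (by positivity)]
        have : (1 : ℝ) ≤ p := by exact_mod_cast hp
        nlinarith
    set C := Real.exp (-(2 * p)) * 2⁻¹ ^ p with hC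
    have hpt : ∀ z : ℝ, 0 ≤ z → (z ^ 2 / c) ^ p / p.factorial ≤ C * Real.exp (t * z) := by
      intro z hz
      have h1 := Real.pow_div_factorial_le_exp (t * z) (mul_nonneg ht0 hz) (2 * p)
      have h2 : ((2 * p).factorial : ℝ) ≤ (2 * p) ^ p * p.factorial := by
        exact_mod_cast Nat.factorial_two_mul_le p
      have h3 : (z ^ 2 / c) ^ p / p.factorial =
          C * (((t * z) ^ (2 * p)) / ((2 * p) ^ p * p.factorial)) := by
        rcases Nat.eq_zero_or_pos p with rfl | hp
        · simp [hC]
        have hp' : (p : ℝ) ≠ 0 := by positivity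
        have h4 : Real.exp (-(2 * p)) = (Real.exp 2)⁻¹ ^ p := by
          rw [← Real.exp_neg, ← Real.exp_nat_mul]; congr 1; ring
        have h5 : (t * z) ^ 2 = p * z ^ 2 / a ^ 2 := by
          rw [eq_div_iff (by positivity)]; linear_combination z ^ 2 * hta2
        rw [hC, h4, pow_mul, h5, hc, ← mul_pow, div_mul_eq_div_div _ (_ ^ p), ← div_pow, ← mul_div_assoc,
          ← mul_pow]
        congr 2
        field_simp
        norm_num
      rw [h3]
      gcongr
      refine le_trans ?_ h1
      gcongr
    calc ∫⁻ x, ENNReal.ofReal ((Z x ^ 2 / c) ^ p / p.factorial) ∂ν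
        ≤ ∫⁻ x, ENNReal.ofReal C * ENNReal.ofReal (Real.exp (t * Z x)) ∂ν := by
          refine lintegral_mono_ae ?_
          filter_upwards [hZ₀] with x hx
          rw [← ENNReal.ofReal_mul (by positivity)]
          exact ENNReal.ofReal_le_ofReal (hpt _ hx)
      _ = ENNReal.ofReal C * ∫⁻ x, ENNReal.ofReal (Real.exp (t * Z x)) ∂ν :=
          lintegral_const_mul' _ _ ENNReal.ofReal_ne_top
      _ ≤ ENNReal.ofReal C * ENNReal.ofReal (Real.exp (2 * p)) := by
          refine mul_le_mul_right ((hmgf t ht0).trans (ENNReal.ofReal_le_ofReal ?_)) _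
          rw [Real.exp_le_exp, hta, hta2]; linarith
      _ = _ := by
          rw [← ENNReal.ofReal_mul (by positivity), hC, mul_right_comm, ← Real.exp_add]
          simp [ENNReal.ofReal_pow, ENNReal.ofReal_inv_of_pos, ENNReal.inv_pow]
  calc _ = ∫⁻ x, ∑' p : ℕ, ENNReal.ofReal ((Z x ^ 2 / c) ^ p / p.factorial) ∂ν :=
        lintegral_congr hexp
    _ = ∑' p : ℕ, ∫⁻ x, ENNReal.ofReal ((Z x ^ 2 / c) ^ p / p.factorial) ∂ν :=
        lintegral_tsum fun p => by fun_prop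
    _ ≤ ∑' p : ℕ, (2⁻¹ : ℝ≥0∞) ^ p := ENNReal.tsum_le_tsum hterm
    _ = 2 := by rw [ENNReal.tsum_geometric]; simp

namespace TruncGGM

theorem le_cX {m : ℕ} (μ : Fin m → ℝ) (K : Matrix (Fin m) (Fin m) ℝ) (k : Fin m) :
    K⁻¹ k k ≤ cX μ K ^ 2 ∧ ∫ x, x k ∂(truncNormal μ K) ≤ cX μ K := by
  have hE : ∀ j, 0 ≤ ∫ x, x j ∂(truncNormal μ K) := fun j => by
    refine integral_nonneg_of_ae ?_
    filter_upwards [ae_pos_truncNormal μ K] with x hx using (hx j).le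
  have h1 : (2 * Real.sqrt (K⁻¹ k k) + Real.sqrt (Real.exp 1) * ∫ x, x k ∂(truncNormal μ K)) ≤
      ⨆ j, (2 * Real.sqrt (K⁻¹ j j) + Real.sqrt (Real.exp 1) * ∫ x, x j ∂(truncNormal μ K)) :=
    le_ciSup (f := fun j => 2 * Real.sqrt (K⁻¹ j j) +
      Real.sqrt (Real.exp 1) * ∫ x, x j ∂(truncNormal μ K)) (finite_range _).bddAbove k
  have h2 : 1 ≤ Real.sqrt (Real.exp 1) := by
    rw [Real.one_le_sqrt]; exact Real.one_le_exp zero_le_one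
  have h3 := Real.sqrt_nonneg (K⁻¹ k k)
  have h4 := mul_le_mul_of_nonneg_right h2 (hE k)
  have h5 := hE k
  unfold cX
  constructor
  · refine (Real.sqrt_le_iff.1 ?_).2
    linarith
  · linarith

/-- Convexity of `exp`: averaging the two exponents reduces to one coordinate, at the price of
doubling the scale. -/
theorem lintegral_exp_sq_add_sq_le_two {m : ℕ} (μ : Fin m → ℝ) {K : Matrix (Fin m) (Fin m) ℝ}
    (hK : K.PosDef) [IsProbabilityMeasure (truncNormal μ K)] {a : ℝ} (ha : 0 < a)
    (hcX : cX μ K ≤ a) (k l : Fin m) :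
    ∫⁻ x, ENNReal.ofReal (Real.exp ((x k ^ 2 + x l ^ 2) / (8 * Real.exp 2 * a ^ 2)))
      ∂(truncNormal μ K) ≤ 2 := by
  have h : ∀ j : Fin m, ∫⁻ x, ENNReal.ofReal (Real.exp (x j ^ 2 / (4 * Real.exp 2 * a ^ 2)))
      ∂(truncNormal μ K) ≤ 2 := fun j => by
    refine lintegral_exp_sq_le_two (measurable_pi_apply j).aemeasurable ?_ ha fun t ht => ?_
    · filter_upwards [ae_pos_truncNormal μ K] with x hx using (hx j).le
    · rw [← ofReal_integral_eq_lintegral_ofReal (integrable_exp_mul_truncNormal μ hK t j)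
        (ae_of_all _ fun x => (Real.exp_pos _).le)]
      refine ENNReal.ofReal_le_ofReal ((integral_exp_mul_le μ hK t j).trans ?_)
      obtain ⟨h1, h2⟩ := le_cX μ K j
      have h0 : 0 ≤ cX μ K := by
        refine le_trans (integral_nonneg_of_ae ?_) h2
        filter_upwards [ae_pos_truncNormal μ K] with x hx using (hx j).le
      gcongr
      · exact h1.trans (by gcongr)
      · exact h2.trans hcX
  calc _ ≤ ∫⁻ x, ENNReal.ofReal 2⁻¹ *
        (ENNReal.ofReal (Real.exp (x k ^ 2 / (4 * Real.exp 2 * a ^ 2))) +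
          ENNReal.ofReal (Real.exp (x l ^ 2 / (4 * Real.exp 2 * a ^ 2)))) ∂(truncNormal μ K) := by
        refine lintegral_mono fun x => ?_
        rw [← ENNReal.ofReal_add (Real.exp_pos _).le (Real.exp_pos _).le,
          ← ENNReal.ofReal_mul (by norm_num)]
        refine ENNReal.ofReal_le_ofReal ?_
        have := convexOn_exp.2 (mem_univ (x k ^ 2 / (4 * Real.exp 2 * a ^ 2)))
          (mem_univ (x l ^ 2 / (4 * Real.exp 2 * a ^ 2)))
          (by norm_num : (0 : ℝ) ≤ 2⁻¹) (by norm_num : (0 : ℝ) ≤ 2⁻¹) (by norm_num)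
        simp only [smul_eq_mul] at this
        rw [mul_add]
        refine le_trans (le_of_eq ?_) this
        congr 1
        field_simp
        ring
    _ = ENNReal.ofReal 2⁻¹ *
        (∫⁻ x, ENNReal.ofReal (Real.exp (x k ^ 2 / (4 * Real.exp 2 * a ^ 2))) ∂(truncNormal μ K) +
          ∫⁻ x, ENNReal.ofReal (Real.exp (x l ^ 2 / (4 * Real.exp 2 * a ^ 2)))
            ∂(truncNormal μ K)) := by
        rw [lintegral_const_mul' _ _ ENNReal.ofReal_ne_top, lintegral_add_left (by fun_prop)]
    _ ≤ ENNReal.ofReal 2⁻¹ * (2 + 2) := by gcongr <;> apply h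
    _ = 2 := by
        rw [ENNReal.ofReal_inv_of_pos (by norm_num), ← two_mul, ← mul_assoc]
        simp [ENNReal.inv_mul_cancel]

end TruncGGM

/-! ### A Bernstein inequality -/

theorem Real.exp_le_one_add_add_sq_mul_exp_abs (y : ℝ) :
    Real.exp y ≤ 1 + y + y ^ 2 * Real.exp |y| := by
  rcases le_or_gt |y| 1 with h | h
  · have h1 := (abs_le.1 (Real.abs_exp_sub_one_sub_id_le h)).2
    have h2 := Real.one_le_exp (abs_nonneg y)
    nlinarith [sq_nonneg y]
  · rcases lt_abs.1 h with h | h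
    · rw [abs_of_pos (by linarith)]
      nlinarith [mul_nonneg (Real.exp_pos y).le (by nlinarith : (0 : ℝ) ≤ y ^ 2 - 1)]
    · have h1 : Real.exp y ≤ 1 := Real.exp_le_one_iff.2 (by linarith)
      have h2 := Real.one_le_exp (abs_nonneg y)
      nlinarith [sq_nonneg y]

/-- The remainder `(sv)² exp|sv|` is absorbed by using one factor `exp(|v|/b)` for the square and
another for the exponential; hence the moments of `exp(2|v|/b)` used throughout. -/
theorem Real.exp_mul_le_of_abs_mul_le_one {s b : ℝ} (hb : 0 < b) (hs : |s| * b ≤ 1) (v : ℝ) :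
    Real.exp (s * v) ≤ 1 + s * v + 2 * (s * b) ^ 2 * Real.exp (2 * |v| / b) := by
  refine (Real.exp_le_one_add_add_sq_mul_exp_abs _).trans ?_
  have hu : 0 ≤ |v| / b := by positivity
  have h1 : (s * v) ^ 2 = (s * b) ^ 2 * (|v| / b) ^ 2 := by
    rw [div_pow, sq_abs]; field_simp
  have h2 : |s * v| ≤ |v| / b := by
    rw [abs_mul, le_div_iff₀ hb]; nlinarith [abs_nonneg v]
  have h3 := Real.pow_div_factorial_le_exp (|v| / b) hu 2
  have h4 : Real.exp (2 * |v| / b) = Real.exp (|v| / b) * Real.exp (|v| / b) := by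
    rw [← Real.exp_add]; congr 1; ring
  have h5 := Real.exp_le_exp.2 h2
  norm_num at h3
  rw [h1, h4]
  have h6 : (|v| / b) ^ 2 * Real.exp |s * v| ≤
      (2 * Real.exp (|v| / b)) * Real.exp (|v| / b) := by
    gcongr; linarith
  nlinarith [sq_nonneg (s * b)]

section Bernstein

variable {α : Type*} [MeasurableSpace α] {ν : Measure α}

theorem integrable_of_lintegral_exp_abs_le {w : α → ℝ} (hw : AEMeasurable w ν) {b A : ℝ} (hb : 0 < b)
    (h : ∫⁻ x, ENNReal.ofReal (Real.exp (2 * |w x| / b)) ∂ν ≤ ENNReal.ofReal A) :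
    Integrable (fun x => Real.exp (2 * |w x| / b)) ν ∧ Integrable w ν := by
  have h1 : Integrable (fun x => Real.exp (2 * |w x| / b)) ν := by
    refine ⟨AEMeasurable.aestronglyMeasurable (by fun_prop), ?_⟩
    rw [hasFiniteIntegral_iff_ofReal (ae_of_all _ fun x => (Real.exp_pos _).le)]
    exact h.trans_lt ENNReal.ofReal_lt_top
  refine ⟨h1, (h1.const_mul b).mono' hw.aestronglyMeasurable (ae_of_all _ fun x => ?_)⟩
  have h2 := Real.add_one_le_exp (2 * |w x| / b)
  have h3 : |w x| = b * (|w x| / b) := by field_simp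
  rw [Real.norm_eq_abs, h3]
  refine mul_le_mul_of_nonneg_left ?_ hb.le
  rw [mul_div_assoc] at h2
  have : 0 ≤ |w x| / b := by positivity
  rw [← h3, mul_div_assoc]
  linarith

theorem integral_exp_le_of_lintegral_exp_abs_le {w : α → ℝ} {b A : ℝ} (hA : 0 ≤ A)
    (h1 : Integrable (fun x => Real.exp (2 * |w x| / b)) ν)
    (h : ∫⁻ x, ENNReal.ofReal (Real.exp (2 * |w x| / b)) ∂ν ≤ ENNReal.ofReal A) :
    ∫ x, Real.exp (2 * |w x| / b) ∂ν ≤ A := by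
  rw [← ofReal_integral_eq_lintegral_ofReal h1 (ae_of_all _ fun x => (Real.exp_pos _).le)] at h
  exact (ENNReal.ofReal_le_ofReal_iff hA).1 h

/-- Centering preserves exponential moments, up to the constant. -/
theorem integral_exp_abs_sub_integral_le {w : α → ℝ} (hw : AEMeasurable w ν) {b A : ℝ}
    (hb : 0 < b) (hA : 0 ≤ A)
    (h : ∫⁻ x, ENNReal.ofReal (Real.exp (2 * |w x| / b)) ∂ν ≤ ENNReal.ofReal A) :
    Integrable (fun x => Real.exp (2 * |w x - ∫ y, w y ∂ν| / b)) ν ∧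
    ∫ x, Real.exp (2 * |w x - ∫ y, w y ∂ν| / b) ∂ν ≤ A * Real.exp A := by
  obtain ⟨h1, h2⟩ := integrable_of_lintegral_exp_abs_le hw hb h
  have h3 := integral_exp_le_of_lintegral_exp_abs_le hA h1 h
  set E := ∫ y, w y ∂ν
  -- Since `y ≤ exp y`, the mean is controlled by the same moment, so centering costs only the
  -- factor `exp A`.
  have hE : 2 * |E| / b ≤ A := by
    calc 2 * |E| / b ≤ 2 * (∫ x, |w x| ∂ν) / b := by
          gcongr; exact abs_integral_le_integral_abs
      _ = ∫ x, 2 * |w x| / b ∂ν := by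
          rw [integral_div, integral_const_mul]
      _ ≤ ∫ x, Real.exp (2 * |w x| / b) ∂ν := by
          refine integral_mono ((h2.abs.const_mul 2).div_const b) h1 fun x => ?_
          linarith [Real.add_one_le_exp (2 * |w x| / b)]
      _ ≤ A := h3
  have hpt : ∀ x, Real.exp (2 * |w x - E| / b) ≤ Real.exp (2 * |w x| / b) * Real.exp A := by
    intro x
    rw [← Real.exp_add]
    refine Real.exp_le_exp.2 ?_
    calc 2 * |w x - E| / b ≤ 2 * (|w x| + |E|) / b := by gcongr; exact abs_sub _ _
      _ = 2 * |w x| / b + 2 * |E| / b := by ring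
      _ ≤ _ := by gcongr
  have h4 : Integrable (fun x => Real.exp (2 * |w x - E| / b)) ν := by
    refine (h1.mul_const (Real.exp A)).mono' (AEMeasurable.aestronglyMeasurable (by fun_prop))
      (ae_of_all _ fun x => ?_)
    rw [Real.norm_of_nonneg (Real.exp_pos _).le]
    exact hpt x
  refine ⟨h4, ?_⟩
  calc _ ≤ ∫ x, Real.exp (2 * |w x| / b) * Real.exp A ∂ν :=
        integral_mono h4 (h1.mul_const _) hpt
    _ = (∫ x, Real.exp (2 * |w x| / b) ∂ν) * Real.exp A := integral_mul_const _ _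
    _ ≤ _ := by gcongr

variable [IsProbabilityMeasure ν]

/-- The moment generating function of a centered sub-exponential variable. -/
theorem mgf_le_exp_sq_of_integral_eq_zero {v : α → ℝ} (hv : AEMeasurable v ν) (hv₀ : ∫ x, v x ∂ν = 0)
    (hvi : Integrable v ν) {b A : ℝ} (hb : 0 < b)
    (h : Integrable (fun x => Real.exp (2 * |v x| / b)) ν)
    (h' : ∫ x, Real.exp (2 * |v x| / b) ∂ν ≤ A) {s : ℝ} (hs : |s| * b ≤ 1) :
    Integrable (fun x => Real.exp (s * v x)) ν ∧ mgf v ν s ≤ Real.exp (2 * A * (s * b) ^ 2) := by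
  have hpt := fun x => Real.exp_mul_le_of_abs_mul_le_one hb hs (v x)
  have hi1 : Integrable (fun x => 1 + s * v x) ν := (integrable_const _).add (hvi.const_mul _)
  have hi2 := h.const_mul (2 * (s * b) ^ 2)
  have hi : Integrable (fun x => Real.exp (s * v x)) ν := by
    refine (hi1.add hi2).mono' (AEMeasurable.aestronglyMeasurable (by fun_prop))
      (ae_of_all _ fun x => ?_)
    rw [Real.norm_of_nonneg (Real.exp_pos _).le]
    exact hpt x
  refine ⟨hi, ?_⟩
  calc mgf v ν s ≤ ∫ x, (1 + s * v x + 2 * (s * b) ^ 2 * Real.exp (2 * |v x| / b)) ∂ν :=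
        integral_mono hi (hi1.add hi2) hpt
    _ = 1 + 2 * (s * b) ^ 2 * ∫ x, Real.exp (2 * |v x| / b) ∂ν := by
        rw [integral_add hi1 hi2, integral_add (integrable_const _) (hvi.const_mul _),
          integral_const_mul, integral_const_mul, hv₀]
        simp
    _ ≤ 1 + 2 * (s * b) ^ 2 * A := by gcongr
    _ ≤ _ := by linarith [Real.add_one_le_exp (2 * A * (s * b) ^ 2)]

variable {Ω : Type*} [MeasurableSpace Ω] {P : Measure Ω} [IsProbabilityMeasure P]

/-- The one-sided Chernoff bound for sums of independent copies of a centered sub-exponential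
variable. -/
theorem measure_sum_ge_le {n : ℕ} {X : Fin n → Ω → α} (hX : iIndepFun X P)
    (hlaw : ∀ i, HasLaw (X i) ν P) {v : α → ℝ} (hv : AEMeasurable v ν) {s L ε : ℝ} (hs : 0 ≤ s)
    (hi : Integrable (fun x => Real.exp (s * v x)) ν) (hL : mgf v ν s ≤ Real.exp L) :
    P {ω | ε ≤ ∑ i, v (X i ω)} ≤ ENNReal.ofReal (Real.exp (-s * ε + n * L)) := by
  set V : Fin n → Ω → ℝ := fun i => v ∘ X i
  have hVm : ∀ i, AEMeasurable (V i) P := fun i => by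
    refine AEMeasurable.comp_aemeasurable ?_ (hlaw i).aemeasurable
    rw [(hlaw i).map_eq]; exact hv
  have hV : iIndepFun V P := hX.comp₀ _ (fun i => (hlaw i).aemeasurable) fun i => by
    rw [(hlaw i).map_eq]; exact hv
  have hmgf : ∀ i, mgf (V i) P s = mgf v ν s := fun i =>
    (hlaw i).integral_comp (f := fun x => Real.exp (s * v x)) hi.aestronglyMeasurable
  have hpos : 0 < mgf v ν s := mgf_pos hi
  have hsum : mgf (∑ i, V i) P s = mgf v ν s ^ n := by
    rw [hV.mgf_sum₀ hVm, Finset.prod_congr rfl fun i _ => hmgf i]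
    simp
  -- By convention the integral of a non-integrable function is `0`, whereas independence gives a
  -- positive value.
  have hint : Integrable (fun ω => Real.exp (s * (∑ i, V i) ω)) P := by
    by_contra hcon
    have h0 : mgf (∑ i, V i) P s = 0 := integral_undef hcon
    rw [hsum] at h0
    exact (pow_pos hpos n).ne' h0
  have key := measure_ge_le_exp_mul_mgf ε hs hint
  have heq : {ω | ε ≤ (∑ i, V i) ω} = {ω | ε ≤ ∑ i, v (X i ω)} := by
    ext ω; simp [V, Finset.sum_apply]
  rw [heq] at key
  rw [← ofReal_measureReal]
  refine ENNReal.ofReal_le_ofReal (key.trans ?_)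
  rw [hsum, Real.exp_add, Real.exp_nat_mul]
  gcongr

/-- Bernstein's inequality for the mean of independent copies of a sub-exponential variable. -/
theorem measure_mean_sub_integral_gt_le {n : ℕ} (hn : 0 < n) {X : Fin n → Ω → α}
    (hX : iIndepFun X P) (hlaw : ∀ i, HasLaw (X i) ν P) {w : α → ℝ} (hw : AEMeasurable w ν)
    {b A T : ℝ} (hb : 0 < b) (hA : 0 ≤ A) (hT : 0 ≤ T)
    (h : ∫⁻ x, ENNReal.ofReal (Real.exp (2 * |w x| / b)) ∂ν ≤ ENNReal.ofReal A) :
    P {ω | (2 * (A * Real.exp A) + 2) * b * (Real.sqrt T + T) <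
        |(n : ℝ)⁻¹ * ∑ i, w (X i ω) - ∫ x, w x ∂ν|} ≤
      2 * ENNReal.ofReal (Real.exp (-(2 * (n * T)))) := by
  obtain ⟨-, hwi⟩ := integrable_of_lintegral_exp_abs_le hw hb h
  obtain ⟨h1, h2⟩ := integral_exp_abs_sub_integral_le hw hb hA h
  set E := ∫ y, w y ∂ν with hE
  set A' := A * Real.exp A
  have hA' : 0 ≤ A' := by positivity
  set ε := (2 * A' + 2) * b * (Real.sqrt T + T)
  have hn' : (0 : ℝ) < n := by exact_mod_cast hn
  -- The Chernoff parameter is `s = r / b`: the moment bound needs `s b ≤ 1`, and in both regimes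
  -- `r² ≤ T ≤ r (√T + T)`. The exponent per observation is then at most `-(2A' + 2)T + 2A'T = -2T`.
  set r := min (Real.sqrt T) 1 with hr
  have hr0 : 0 ≤ r := le_min (Real.sqrt_nonneg _) zero_le_one
  have hr1 : r ≤ 1 := min_le_right _ _
  have hsq : Real.sqrt T ^ 2 = T := Real.sq_sqrt hT
  have hr2 : r ^ 2 ≤ T := by
    rw [← hsq]; gcongr; exact min_le_left _ _
  have hr3 : T ≤ r * (Real.sqrt T + T) := by
    rcases le_total (Real.sqrt T) 1 with hle | hle
    · rw [hr, min_eq_left hle]; nlinarith [Real.sqrt_nonneg T]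
    · rw [hr, min_eq_right hle]; linarith [Real.sqrt_nonneg T]
  set s := r / b with hs
  have hs0 : 0 ≤ s := by positivity
  have hsb : s * b = r := by rw [hs]; field_simp
  have hexp : -s * (n * ε) + n * (2 * A' * (s * b) ^ 2) ≤ -(2 * (n * T)) := by
    have h3 : s * ε = (2 * A' + 2) * (r * (Real.sqrt T + T)) := by
      rw [← hsb]; ring
    rw [hsb]
    have h4 : (2 * A' + 2) * T ≤ s * ε := by rw [h3]; gcongr
    have h5 : 2 * A' * r ^ 2 ≤ 2 * A' * T := by gcongr
    nlinarith
  -- One statement serves both tails, `w - E` and `E - w`, whose absolute values agree.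
  have hcent : ∀ v : α → ℝ, AEMeasurable v ν → ∫ x, v x ∂ν = 0 → Integrable v ν →
      (fun x => |v x|) = (fun x => |w x - E|) →
      P {ω | n * ε ≤ ∑ i, v (X i ω)} ≤ ENNReal.ofReal (Real.exp (-(2 * (n * T)))) := by
    intro v hv hv0 hvi habs
    have habs' : ∀ x, |v x| = |w x - E| := fun x => congrFun habs x
    obtain ⟨h6, h7⟩ := mgf_le_exp_sq_of_integral_eq_zero hv hv0 hvi hb (A := A')
      (by simpa only [habs'] using h1) (by simpa only [habs'] using h2) (s := s)
      (by rw [abs_of_nonneg hs0, hsb]; exact hr1)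
    exact (measure_sum_ge_le hX hlaw hv hs0 h6 h7).trans
      (ENNReal.ofReal_le_ofReal (Real.exp_le_exp.2 hexp))
  have hi0 : Integrable (fun x => w x - E) ν := hwi.sub (integrable_const _)
  have hz : ∫ x, (w x - E) ∂ν = 0 := by
    rw [integral_sub hwi (integrable_const _)]; simp [hE]
  have hp := hcent (fun x => w x - E) (by fun_prop) hz hi0 rfl
  have hm := hcent (fun x => -(w x - E)) (by fun_prop) (by rw [integral_neg, hz, neg_zero])
    hi0.neg (by simp only [abs_neg])
  refine (measure_mono (t := {ω | n * ε ≤ ∑ i, (w (X i ω) - E)} ∪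
    {ω | n * ε ≤ ∑ i, -(w (X i ω) - E)}) fun ω hω => ?_).trans
    ((measure_union_le _ _).trans ((add_le_add hp hm).trans_eq (two_mul _).symm))
  have hω' : ε < |(n : ℝ)⁻¹ * ∑ i, w (X i ω) - E| := hω
  have h8 : ∑ i, (w (X i ω) - E) = n * ((n : ℝ)⁻¹ * ∑ i, w (X i ω) - E) := by
    rw [Finset.sum_sub_distrib]
    simp
    field_simp
  simp only [mem_union, mem_ofPred_eq, Finset.sum_neg_distrib]
  rw [h8, ← mul_neg]
  rcases lt_abs.1 hω' with h9 | h9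
  · left; gcongr
  · right; gcongr

end Bernstein

/-! ### Integration by parts and the score matching identity -/

/-- No boundary term survives: at `0` because `f 0 = 0`, at infinity because `f g` has a limit there
and an integrable function on the half line can only have limit `0`. -/
theorem integral_Ioi_deriv_mul_add_mul_deriv_eq_zero {f g : ℝ → ℝ}
    (hf : ∀ b, 0 ≤ b → AbsolutelyContinuousOnInterval f 0 b) (hf₀ : f 0 = 0)
    (hg : ContDiff ℝ 1 g) (h₀ : IntegrableOn (fun s => f s * g s) (Ioi 0))
    (h₁ : IntegrableOn (fun s => deriv f s * g s + f s * deriv g s) (Ioi 0)) :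
    ∫ s in Ioi 0, (deriv f s * g s + f s * deriv g s) = 0 := by
  have h2 := intervalIntegral_tendsto_integral_Ioi 0 h₁ tendsto_id
  have h3 : Tendsto (fun b => f b * g b) atTop
      (𝓝 (∫ s in Ioi 0, (deriv f s * g s + f s * deriv g s))) := by
    refine h2.congr' ?_
    filter_upwards [eventually_ge_atTop 0] with b hb
    rw [id, (hf b hb).integral_deriv_mul_eq_sub hg.contDiffOn.absolutelyContinuousOnInterval, hf₀]
    ring
  refine IntegrableAtFilter.eq_zero_of_tendsto (μ := volume) ⟨Ioi 0, Ioi_mem_atTop 0, h₀⟩ ?_ h3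
  intro s hs
  obtain ⟨b, hb⟩ := mem_atTop_sets.1 hs
  refine top_le_iff.1 ((Real.volume_Ici (a := b)).symm.le.trans (measure_mono hb))

/-- Fubini with coordinate `j` innermost. The slice condition may assume integrability, which Fubini
supplies for almost every `y`. -/
theorem setIntegral_orthant_eq_zero {m : ℕ} (j : Fin (m + 1)) {G D : (Fin (m + 1) → ℝ) → ℝ}
    (hG : IntegrableOn G {x | ∀ i, 0 ≤ x i}) (hD : IntegrableOn D {x | ∀ i, 0 ≤ x i})
    (hslice : ∀ y : Fin m → ℝ, IntegrableOn (fun s => G (j.insertNth s y)) (Ioi 0) →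
      IntegrableOn (fun s => D (j.insertNth s y)) (Ioi 0) →
      ∫ s in Ioi 0, D (j.insertNth s y) = 0) :
    ∫ x in {x | ∀ i, 0 ≤ x i}, D x = 0 := by
  let e := (MeasurableEquiv.piFinSuccAbove (fun _ : Fin (m + 1) => ℝ) j).symm
  have he : MeasurePreserving e := (volume_preserving_piFinSuccAbove (fun _ => ℝ) j).symm _
  have heq : ∀ s y, e (s, y) = j.insertNth s y := fun s y => rfl
  have hpre : e ⁻¹' {x | ∀ i, 0 ≤ x i} = Ici (0 : ℝ) ×ˢ {y : Fin m → ℝ | ∀ i, 0 ≤ y i} := by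
    ext ⟨s, y⟩
    simp only [mem_preimage, mem_ofPred_eq, heq, mem_prod, mem_Ici]
    rw [Fin.forall_iff_succAbove j]
    simp
  have hint : ∀ {u : (Fin (m + 1) → ℝ) → ℝ}, IntegrableOn u {x | ∀ i, 0 ≤ x i} →
      Integrable (fun z : ℝ × (Fin m → ℝ) => u (e z)) ((volume.restrict (Ioi 0)).prod
        (volume.restrict {y : Fin m → ℝ | ∀ i, 0 ≤ y i})) := by
    intro u hu
    rw [← he.integrableOn_comp_preimage e.measurableEmbedding, hpre, IntegrableOn,
      Measure.volume_eq_prod, ← Measure.prod_restrict] at hu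
    rwa [restrict_Ioi_eq_restrict_Ici]
  rw [← he.setIntegral_preimage_emb e.measurableEmbedding, hpre, Measure.volume_eq_prod,
    ← Measure.prod_restrict, ← restrict_Ioi_eq_restrict_Ici, integral_prod_symm _ (hint hD)]
  rw [integral_congr_ae (g := fun _ => 0), integral_zero]
  filter_upwards [(hint hG).prod_left_ae, (hint hD).prod_left_ae] with y h1 h2
  exact hslice y h1 h2

namespace TruncGGM

/-- The observation `x` extended by the entry `-1`. -/
def extVec {m : ℕ} (x : Fin m → ℝ) : Fin m ⊕ Unit → ℝ :=
  Sum.elim x fun _ => -1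

theorem insertNth_eq_add_smul {m : ℕ} (j : Fin (m + 1)) (s : ℝ) (y : Fin m → ℝ) :
    (j.insertNth s y : Fin (m + 1) → ℝ) = j.insertNth 0 y + s • Pi.single j 1 := by
  ext i
  refine j.succAboveCases ?_ (fun i => ?_) i
  · simp
  · simp [Fin.succAbove_ne]

theorem truncDensity_add_smul {m : ℕ} (μ : Fin m → ℝ) {K : Matrix (Fin m) (Fin m) ℝ}
    (hK : K.IsHermitian) (x : Fin m → ℝ) (j : Fin m) (s : ℝ) :
    truncDensity μ K (x + s • Pi.single j 1) = Real.exp (-(1 / 2) *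
      ((x - μ) ⬝ᵥ (K *ᵥ (x - μ)) + 2 * s * (K *ᵥ (x - μ)) j + s ^ 2 * K j j)) := by
  unfold truncDensity
  congr 2
  have h1 : x + s • Pi.single j 1 - μ = (x - μ) + s • Pi.single j (1 : ℝ) := by abel
  have h2 := dotProduct_mulVec_comm_of_isHermitian hK (x - μ) (Pi.single j (1 : ℝ))
  have h3 : ∀ u : Fin m → ℝ, Pi.single j (1 : ℝ) ⬝ᵥ u = u j := fun u => by simp
  rw [h1, mulVec_add, mulVec_smul, add_dotProduct, dotProduct_add, dotProduct_add,
    smul_dotProduct, smul_dotProduct, dotProduct_smul, dotProduct_smul, h2, h3, h3]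
  simp
  ring

theorem contDiff_hasDerivAt_extVec_mul_truncDensity {m : ℕ} (μ : Fin (m + 1) → ℝ)
    {K : Matrix (Fin (m + 1)) (Fin (m + 1)) ℝ} (hK : K.IsHermitian) (j : Fin (m + 1))
    (y : Fin m → ℝ) (a : Fin (m + 1) ⊕ Unit) :
    ContDiff ℝ 1 (fun s : ℝ => extVec (j.insertNth s y) a * truncDensity μ K (j.insertNth s y)) ∧
    ∀ s, deriv (fun s : ℝ => extVec (j.insertNth s y) a * truncDensity μ K (j.insertNth s y)) s =
      ((if a = Sum.inl j then 1 else 0) - extVec (j.insertNth s y) a *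
        (K *ᵥ (j.insertNth s y - μ)) j) * truncDensity μ K (j.insertNth s y) := by
  set x₀ : Fin (m + 1) → ℝ := j.insertNth 0 y
  have hx : ∀ s : ℝ, (j.insertNth s y : Fin (m + 1) → ℝ) = x₀ + s • Pi.single j 1 :=
    fun s => insertNth_eq_add_smul j s y
  set q : ℝ := if a = Sum.inl j then 1 else 0 with hq
  have hext : ∀ s : ℝ, extVec (j.insertNth s y) a = extVec x₀ a + s * q := by
    intro s
    rw [hx, hq]
    rcases a with k | u
    · simp [extVec, Pi.single_apply, Sum.inl.injEq]
    · simp [extVec]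
  have hmul : ∀ s : ℝ, (K *ᵥ (j.insertNth s y - μ)) j = (K *ᵥ (x₀ - μ)) j + s * K j j := by
    intro s
    rw [hx, add_sub_right_comm, mulVec_add, mulVec_smul]
    simp
  simp only [hext, hmul]
  simp only [hx, truncDensity_add_smul μ hK]
  set A := (x₀ - μ) ⬝ᵥ (K *ᵥ (x₀ - μ))
  set B := (K *ᵥ (x₀ - μ)) j
  refine ⟨by fun_prop, fun s => ?_⟩
  have h1 : HasDerivAt (fun s : ℝ => extVec x₀ a + s * q) q s := by
    simpa using ((hasDerivAt_id s).mul_const q).const_add (extVec x₀ a)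
  have h2 : HasDerivAt (fun s : ℝ => -(1 / 2) * (A + 2 * s * B + s ^ 2 * K j j))
      (-(B + s * K j j)) s := by
    have h3 : HasDerivAt (fun s : ℝ => -(1 / 2) * (A + 2 * s * B + s ^ 2 * K j j))
        (-(1 / 2) * (2 * 1 * B + (2 : ℕ) * s ^ (2 - 1) * 1 * K j j)) s :=
      (((((hasDerivAt_id' s).const_mul 2).mul_const B).const_add A).fun_add
        (((hasDerivAt_id' s).fun_pow 2).mul_const (K j j))).const_mul (-(1 / 2))
    refine h3.congr_deriv ?_
    norm_num
    ring
  rw [(h1.fun_mul h2.exp).deriv]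
  ring

theorem integrable_truncNormal_iff {m : ℕ} (μ : Fin m → ℝ) (K : Matrix (Fin m) (Fin m) ℝ)
    [IsProbabilityMeasure (truncNormal μ K)] (u : (Fin m → ℝ) → ℝ) :
    Integrable u (truncNormal μ K) ↔
      IntegrableOn (fun x => u x * truncDensity μ K x) {x | ∀ j, 0 ≤ x j} := by
  obtain ⟨h0, h1⟩ := truncNormalUnnorm_univ_ne μ K
  rw [truncNormal, integrable_smul_measure (ENNReal.inv_ne_zero.2 h1) (ENNReal.inv_ne_top.2 h0),
    truncNormalUnnorm_eq, integrable_withDensity_iff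
      (continuous_truncDensity μ K).measurable.ennreal_ofReal (by simp)]
  simp only [ENNReal.toReal_ofReal (truncDensity_pos μ K _).le]
  rfl

theorem integral_truncNormal {m : ℕ} (μ : Fin m → ℝ) (K : Matrix (Fin m) (Fin m) ℝ)
    (u : (Fin m → ℝ) → ℝ) :
    ∫ x, u x ∂(truncNormal μ K) = ((truncNormalUnnorm μ K univ)⁻¹).toReal *
      ∫ x in {x | ∀ j, 0 ≤ x j}, u x * truncDensity μ K x := by
  rw [truncNormal, integral_smul_measure, truncNormalUnnorm_eq,
    integral_withDensity_eq_integral_toReal_smul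
      (continuous_truncDensity μ K).measurable.ennreal_ofReal (by simp), smul_eq_mul]
  simp only [ENNReal.toReal_ofReal (truncDensity_pos μ K _).le, smul_eq_mul, mul_comm]

/-- The score matching identity: integration by parts in the `j`-th coordinate. -/
theorem integral_mul_score_eq {m : ℕ} (μ : Fin m → ℝ) {K : Matrix (Fin m) (Fin m) ℝ}
    (hK : K.IsHermitian) [IsProbabilityMeasure (truncNormal μ K)] {f : ℝ → ℝ}
    (hf : ∀ b, 0 ≤ b → AbsolutelyContinuousOnInterval f 0 b) (hf₀ : f 0 = 0)
    (j : Fin m) (a : Fin m ⊕ Unit)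
    (h₀ : Integrable (fun x => f (x j) * extVec x a) (truncNormal μ K))
    (h₁ : Integrable (fun x => f (x j) * extVec x a * (K *ᵥ (x - μ)) j) (truncNormal μ K))
    (h₂ : Integrable (fun x => deriv f (x j) * extVec x a +
      (if a = Sum.inl j then 1 else 0) * f (x j)) (truncNormal μ K)) :
    ∫ x, f (x j) * extVec x a * (K *ᵥ (x - μ)) j ∂(truncNormal μ K) =
      ∫ x, (deriv f (x j) * extVec x a + (if a = Sum.inl j then 1 else 0) * f (x j))
        ∂(truncNormal μ K) := by
  obtain _ | m := m
  · exact j.elim0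
  symm
  -- The difference of the integrands, multiplied by the density, is the derivative along coordinate
  -- `j` of `f(x_j) · extVec x a ·` density.
  rw [← sub_eq_zero, ← integral_sub h₂ h₁, integral_truncNormal]
  refine mul_eq_zero_of_right _ (setIntegral_orthant_eq_zero j
    ((integrable_truncNormal_iff μ K _).1 h₀) ((integrable_truncNormal_iff μ K _).1 (h₂.sub h₁))
    fun y hy₀ hy₁ => ?_)
  obtain ⟨hg, hg'⟩ := contDiff_hasDerivAt_extVec_mul_truncDensity μ hK j y a
  have key := integral_Ioi_deriv_mul_add_mul_deriv_eq_zero hf hf₀ hg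
  simp only [hg'] at key
  simp only [Fin.insertNth_apply_same] at hy₀ hy₁ ⊢
  refine Eq.trans (integral_congr_ae (ae_of_all _ fun s => ?_)) (key ?_ ?_)
  · ring
  · exact hy₀.congr (ae_of_all _ fun s => by ring)
  · exact hy₁.congr (ae_of_all _ fun s => by ring)

end TruncGGM

/-! ### The primal-dual witness argument for a regularized quadratic loss -/

namespace TruncGGM

section Quadratic

variable {ι : Type*} [Fintype ι]

/-- The `ℓ1`-regularized quadratic loss. -/
noncomputable def quadLoss (A : Matrix ι ι ℝ) (b : ι → ℝ) (lam : ℝ) (θ : ι → ℝ) : ℝ :=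
  1 / 2 * (θ ⬝ᵥ (A *ᵥ θ)) - b ⬝ᵥ θ + lam * ∑ i, |θ i|

theorem rowSumNorm_nonneg {κ : Type*} (B : Matrix κ ι ℝ) : 0 ≤ rowSumNorm B :=
  Real.iSup_nonneg fun _ => Finset.sum_nonneg fun _ _ => abs_nonneg _

theorem row_sum_le_rowSumNorm {κ : Type*} [Finite κ] (B : Matrix κ ι ℝ) (i : κ) :
    ∑ j, |B i j| ≤ rowSumNorm B :=
  le_ciSup (f := fun i => ∑ j, |B i j|) (finite_range _).bddAbove i

theorem abs_mulVec_le_rowSumNorm_mul {κ : Type*} [Finite κ] (B : Matrix κ ι ℝ) {v : ι → ℝ} {V : ℝ}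
    (hV : 0 ≤ V) (hv : ∀ j, |v j| ≤ V) (i : κ) : |(B *ᵥ v) i| ≤ rowSumNorm B * V := by
  calc |(B *ᵥ v) i| ≤ ∑ j, |B i j * v j| := Finset.abs_sum_le_sum_abs _ _
    _ ≤ ∑ j, |B i j| * V := by
        gcongr with j; rw [abs_mul]; gcongr; exact hv j
    _ = (∑ j, |B i j|) * V := (Finset.sum_mul _ _ _).symm
    _ ≤ _ := by gcongr; exact row_sum_le_rowSumNorm B i

theorem quadLoss_add {A : Matrix ι ι ℝ} (hA : Aᵀ = A) (b : ι → ℝ) (lam : ℝ) (θ v : ι → ℝ) :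
    quadLoss A b lam (θ + v) = quadLoss A b lam θ + (A *ᵥ θ - b) ⬝ᵥ v + 1 / 2 * (v ⬝ᵥ (A *ᵥ v)) +
      lam * ∑ i, (|θ i + v i| - |θ i|) := by
  have h : θ ⬝ᵥ (A *ᵥ v) = (A *ᵥ θ) ⬝ᵥ v := by
    rw [dotProduct_mulVec, ← mulVec_transpose, hA]
  have h' : v ⬝ᵥ (A *ᵥ θ) = (A *ᵥ θ) ⬝ᵥ v := dotProduct_comm _ _
  unfold quadLoss
  rw [mulVec_add, add_dotProduct, dotProduct_add, dotProduct_add, h, h', sub_dotProduct,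
    dotProduct_add, Finset.sum_sub_distrib]
  simp only [Pi.add_apply]
  ring

theorem continuous_quadLoss (A : Matrix ι ι ℝ) (b : ι → ℝ) (lam : ℝ) :
    Continuous (quadLoss A b lam) := by
  unfold quadLoss
  fun_prop

/-- Completing the square bounds the quadratic part below by a constant, so the `ℓ1` penalty alone
gives coercivity. -/
theorem tendsto_quadLoss_cocompact {A : Matrix ι ι ℝ} (hA : A.PosDef) (b : ι → ℝ) {lam : ℝ}
    (hlam : 0 < lam) : Tendsto (quadLoss A b lam) (cocompact (ι → ℝ)) atTop := by
  classical
  have hsymm : Aᵀ = A := by simpa using hA.1.eq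
  have hdet : IsUnit A.det := (isUnit_iff_isUnit_det _).1 hA.isUnit
  set w := A⁻¹ *ᵥ b
  have hw : A *ᵥ w = b := by simp only [w]; rw [mulVec_mulVec, mul_nonsing_inv _ hdet, one_mulVec]
  have hbd : ∀ θ, lam * ‖θ‖ - 1 / 2 * (w ⬝ᵥ b) ≤ quadLoss A b lam θ := by
    intro θ
    have h1 := hA.posSemidef.dotProduct_mulVec_nonneg (θ - w)
    have h2 : w ⬝ᵥ (A *ᵥ θ) = b ⬝ᵥ θ := by
      rw [dotProduct_mulVec, ← mulVec_transpose, hsymm, hw]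
    have h3 : θ ⬝ᵥ b = b ⬝ᵥ θ := dotProduct_comm _ _
    have h4 : ‖θ‖ ≤ ∑ i, |θ i| := by
      rw [pi_norm_le_iff_of_nonneg (Finset.sum_nonneg fun _ _ => abs_nonneg _)]
      intro i
      exact Finset.single_le_sum (f := fun i => |θ i|) (fun _ _ => abs_nonneg _) (Finset.mem_univ i)
    simp only [star_trivial] at h1
    rw [mulVec_sub, sub_dotProduct, dotProduct_sub, dotProduct_sub, hw, h2, h3] at h1
    unfold quadLoss
    nlinarith
  refine tendsto_atTop_mono hbd ?_
  exact tendsto_atTop_add_const_right _ _ (tendsto_norm_cocompact_atTop.const_mul_atTop hlam)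

/-- First-order optimality conditions in one coordinate. -/
theorem abs_le_and_mul_eq_of_forall_nonneg {u c x lam : ℝ} (hlam : 0 ≤ lam)
    (h : ∀ t, 0 ≤ t * u + c * t ^ 2 + lam * (|x + t| - |x|)) :
    |u| ≤ lam ∧ u * x = -(lam * |x|) := by
  -- A quadratic without constant term that is non-negative just to the right of `0` has
  -- non-negative slope there.
  have aux : ∀ p q : ℝ, (∀ t, 0 < t → t ≤ 1 → 0 ≤ t * p + q * t ^ 2) → 0 ≤ p := by
    intro p q hpq
    by_contra! hp
    have hq : 0 < |q| + 1 := by positivity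
    set t := min 1 (-p / (2 * (|q| + 1))) with ht
    have ht0 : 0 < t := lt_min one_pos (div_pos (by linarith) (by positivity))
    have ht1 : t * (2 * (|q| + 1)) ≤ -p := (le_div_iff₀ (by positivity)).1 (min_le_right _ _)
    have h1 := hpq t ht0 (min_le_left _ _)
    have h2 := le_abs_self q
    have h3 : 0 ≤ p + q * t := by
      by_contra! hneg
      nlinarith
    nlinarith [abs_nonneg q]
  -- Moving by `±t` gives `|u| ≤ lam`; rescaling `x` by `1 ± t`, for which the penalty is linear,
  -- gives complementary slackness.
  have h1 : 0 ≤ lam + u := aux _ c fun t ht ht1 => by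
    have := h t
    have h2 : |x + t| - |x| ≤ t := by
      have := abs_add_le x t; rw [abs_of_pos ht] at this; linarith
    nlinarith
  have h2 : 0 ≤ lam - u := aux _ c fun t ht ht1 => by
    have := h (-t)
    have h2 : |x + -t| - |x| ≤ t := by
      have := abs_add_le x (-t); rw [abs_neg, abs_of_pos ht] at this; linarith
    nlinarith
  have h3 : 0 ≤ u * x + lam * |x| := aux _ (c * x ^ 2) fun t ht ht1 => by
    have := h (t * x)
    have h2 : |x + t * x| = (1 + t) * |x| := by
      rw [show x + t * x = (1 + t) * x by ring, abs_mul, abs_of_pos (by linarith)]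
    rw [h2] at this
    nlinarith
  have h4 : 0 ≤ -(u * x + lam * |x|) := aux _ (c * x ^ 2) fun t ht ht1 => by
    have := h (-t * x)
    have h2 : |x + -t * x| = (1 - t) * |x| := by
      rw [show x + -t * x = (1 - t) * x by ring, abs_mul, abs_of_nonneg (by linarith)]
    rw [h2] at this
    nlinarith
  exact ⟨abs_le.2 ⟨by linarith, by linarith⟩, by linarith⟩

/-- The two conditions say that the negative gradient of the smooth part is a subgradient of the
penalty at `θ`. The loss thus exceeds its value at `θ` by at least half the form of `A` at `φ - θ`,
which yields minimality and uniqueness together. -/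
theorem quadLoss_le_of_firstOrder {A : Matrix ι ι ℝ} (hA : A.PosDef) {b : ι → ℝ} {lam : ℝ}
    {θ : ι → ℝ} (h₁ : ∀ i, |(A *ᵥ θ - b) i| ≤ lam)
    (h₂ : ∀ i, (A *ᵥ θ - b) i * θ i = -(lam * |θ i|)) :
    (∀ φ, quadLoss A b lam θ ≤ quadLoss A b lam φ) ∧
      ∀ φ, quadLoss A b lam φ ≤ quadLoss A b lam θ → φ = θ := by
  have hsymm : Aᵀ = A := by simpa using hA.1.eq
  have key : ∀ φ, quadLoss A b lam θ + 1 / 2 * ((φ - θ) ⬝ᵥ (A *ᵥ (φ - θ))) ≤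
      quadLoss A b lam φ := by
    intro φ
    have h3 := quadLoss_add hsymm b lam θ (φ - θ)
    rw [add_sub_cancel] at h3
    have h4 : 0 ≤ (A *ᵥ θ - b) ⬝ᵥ (φ - θ) + lam * ∑ i, (|θ i + (φ - θ) i| - |θ i|) := by
      rw [dotProduct, Finset.mul_sum, ← Finset.sum_add_distrib]
      refine Finset.sum_nonneg fun i _ => ?_
      have h5 : θ i + (φ - θ) i = φ i := by simp
      have h6 := neg_abs_le ((A *ᵥ θ - b) i * φ i)
      rw [abs_mul] at h6
      have h7 := mul_le_mul_of_nonneg_right (h₁ i) (abs_nonneg (φ i))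
      rw [h5, Pi.sub_apply φ θ i, mul_sub, h₂]
      linarith
    linarith
  refine ⟨fun φ => ?_, fun φ hφ => ?_⟩
  · have := hA.posSemidef.dotProduct_mulVec_nonneg (φ - θ)
    simp only [star_trivial] at this
    linarith [key φ]
  · by_contra hne
    have := hA.dotProduct_mulVec_pos (sub_ne_zero.2 hne)
    simp only [star_trivial] at this
    linarith [key φ]

/-- A minimizer of the loss over the vectors supported in `S` exists and satisfies the first-order
conditions on `S`. -/
theorem exists_supported_firstOrder {A : Matrix ι ι ℝ} (hA : A.PosDef) (b : ι → ℝ) {lam : ℝ}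
    (hlam : 0 < lam) (S : Set ι) :
    ∃ θ : ι → ℝ, (∀ i, i ∉ S → θ i = 0) ∧
      ∀ i ∈ S, |(A *ᵥ θ - b) i| ≤ lam ∧ (A *ᵥ θ - b) i * θ i = -(lam * |θ i|) := by
  classical
  have hsymm : Aᵀ = A := by simpa using hA.1.eq
  have hclosed : IsClosed {θ : ι → ℝ | ∀ i, i ∉ S → θ i = 0} := by
    simp only [ofPred_forall]
    exact isClosed_iInter fun i => isClosed_iInter fun _ =>
      isClosed_eq (continuous_apply i) continuous_const
  obtain ⟨θ, hθ, hmin⟩ := (continuous_quadLoss A b lam).continuousOn.exists_isMinOn' hclosed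
    (x₀ := 0) (by simp) (Filter.mem_inf_of_left
      ((tendsto_quadLoss_cocompact hA b hlam).eventually_ge_atTop _))
  refine ⟨θ, hθ, fun i hi => ?_⟩
  refine abs_le_and_mul_eq_of_forall_nonneg (c := 1 / 2 * A i i) hlam.le fun t => ?_
  have h1 : quadLoss A b lam θ ≤ quadLoss A b lam (θ + Pi.single i t) := hmin fun k hk => by
    have : k ≠ i := fun h => hk (h ▸ hi)
    simp [hθ k hk, this]
  rw [quadLoss_add hsymm] at h1
  have h2 : ∑ k, (|θ k + (Pi.single i t : ι → ℝ) k| - |θ k|) = |θ i + t| - |θ i| := by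
    rw [Finset.sum_eq_single i]
    · simp
    · intro k _ hk; simp [hk]
    · simp
  rw [h2] at h1
  have h3 : (Pi.single i t : ι → ℝ) ⬝ᵥ (A *ᵥ Pi.single i t) = A i i * t ^ 2 := by
    simp; ring
  have h4 : (A *ᵥ θ - b) ⬝ᵥ (Pi.single i t : ι → ℝ) = t * (A *ᵥ θ - b) i := by
    simp [mul_comm]
  rw [h3, h4] at h1
  linarith

open Classical in
theorem submatrix_mulVec_of_supported (B : Matrix ι ι ℝ) {S T : Set ι} {v : ι → ℝ}
    (hv : ∀ i, i ∉ S → v i = 0) (i : T) :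
    (subMat B T S *ᵥ fun j : S => v j) i = (B *ᵥ v) i := by
  simp only [mulVec, dotProduct, subMat, submatrix_apply]
  refine (Finset.sum_subtype (Finset.univ.filter (· ∈ S)) (by simp)
    fun j => B i j * v j).symm.trans ?_
  refine Finset.sum_filter_of_ne fun j _ hj => ?_
  by_contra hjS
  exact hj (by rw [hv j hjS, mul_zero])

open Classical in
/-- The primal-dual witness construction. -/
theorem exists_minimizer_of_irrepresentable {A A₀ : Matrix ι ι ℝ} (hA : A.PosDef)
    {b b₀ θ₀ : ι → ℝ} {S : Set ι} (hθ₀ : ∀ i, i ∉ S → θ₀ i = 0) (hpop : A₀ *ᵥ θ₀ = b₀)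
    {α lam κ ρ : ℝ} (hα : 0 < α) (hα₁ : α ≤ 1) (hlam : 0 < lam) (hκ₀ : 0 ≤ κ)
    (hirr : Irrepresentable A₀ S α)
    (hκ : ∀ (v : ι → ℝ) (V : ℝ), 0 ≤ V → (∀ i, i ∉ S → v i = 0) → (∀ i, |v i| ≤ V) →
      ∀ i, |((A - A₀) *ᵥ v) i| ≤ κ * V)
    (hρ : ∀ i, |(b - b₀) i - ((A - A₀) *ᵥ θ₀) i| ≤ ρ)
    (h₁ : cGamma A₀ S * κ ≤ α / 8) (h₂ : (2 - α) * ρ ≤ α * lam / 4) :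
    ∃ θ : ι → ℝ, (∀ i, i ∉ S → θ i = 0) ∧
      (∀ i, |θ i - θ₀ i| ≤ 2 * cGamma A₀ S / (2 - α) * lam) ∧
      (∀ φ, quadLoss A b lam θ ≤ quadLoss A b lam φ) ∧
      ∀ φ, quadLoss A b lam φ ≤ quadLoss A b lam θ → φ = θ := by
  obtain ⟨θ, hθS, hfo⟩ := exists_supported_firstOrder hA b hlam S
  obtain ⟨hunit, hinc⟩ := hirr
  set c := cGamma A₀ S with hc
  have hc0 : 0 ≤ c := rowSumNorm_nonneg _
  set Δ := θ - θ₀ with hΔ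
  have hΔS : ∀ i, i ∉ S → Δ i = 0 := fun i hi => by simp [hΔ, hθS i hi, hθ₀ i hi]
  set V := ‖Δ‖
  have hV : ∀ i, |Δ i| ≤ V := fun i => norm_le_pi_norm Δ i
  set e := κ * V with he
  have hV0 : 0 ≤ V := norm_nonneg _
  have he0 : 0 ≤ e := mul_nonneg hκ₀ hV0
  have hE : ∀ i, |((A - A₀) *ᵥ Δ) i| ≤ e := hκ Δ V hV0 hΔS hV
  have hρ0 : ∀ i : ι, 0 ≤ ρ := fun i => (abs_nonneg _).trans (hρ i)
  -- Population operator on the error = gradient at `θ` + sampling error at `θ₀` - matrix error on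
  -- `Δ`. On `S` these terms are bounded by `lam`, `ρ` and `e`.
  have hid : ∀ i, (A₀ *ᵥ Δ) i = (A *ᵥ θ - b) i + ((b - b₀) i - ((A - A₀) *ᵥ θ₀) i) -
      ((A - A₀) *ᵥ Δ) i := by
    intro i
    rw [← hpop, hΔ, mulVec_sub, sub_mulVec, sub_mulVec, mulVec_sub]
    simp only [Pi.sub_apply]
    rw [mulVec_sub]
    simp only [Pi.sub_apply]
    ring
  set w : S → ℝ := fun i => (A₀ *ᵥ Δ) i with hw
  set ΔS : S → ℝ := fun i => Δ i with hΔSdef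
  have hw' : subMat A₀ S S *ᵥ ΔS = w := funext fun i => submatrix_mulVec_of_supported A₀ hΔS i
  have hdet : IsUnit (subMat A₀ S S).det := (isUnit_iff_isUnit_det _).1 hunit
  have hsol : (subMat A₀ S S)⁻¹ *ᵥ w = ΔS := by
    rw [← hw', mulVec_mulVec, nonsing_inv_mul _ hdet, one_mulVec]
  have hwb : ∀ i : S, |w i| ≤ lam + ρ + e := by
    intro i
    simp only [hw]
    rw [hid]
    refine (abs_sub _ _).trans (add_le_add ((abs_add_le _ _).trans
      (add_le_add (hfo i i.2).1 (hρ i))) (hE i))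
  -- An index is needed to infer `0 ≤ ρ` from its bound.
  by_cases hne : IsEmpty ι
  · exact ⟨θ, hθS, fun i => (hne.false i).elim, fun φ => by rw [Subsingleton.elim φ θ],
      fun φ _ => Subsingleton.elim φ θ⟩
  obtain ⟨i₀⟩ := not_isEmpty_iff.1 hne
  have hρ0 := hρ0 i₀
  have hs0 : 0 ≤ lam + ρ + e := by positivity
  have hVle : V ≤ c * (lam + ρ + e) := by
    rw [pi_norm_le_iff_of_nonneg (by positivity)]
    intro i
    by_cases hi : i ∈ S
    · have := abs_mulVec_le_rowSumNorm_mul (subMat A₀ S S)⁻¹ hs0 hwb ⟨i, hi⟩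
      rw [hsol] at this
      exact this
    · rw [hΔS i hi, norm_zero]; positivity
  -- The bound on `V` involves `e = κ V` itself; since `c κ ≤ α / 8`, the inequality closes and can
  -- be solved for `e`.
  have he1 : e ≤ α / 8 * (lam + ρ + e) := by
    calc e ≤ κ * (c * (lam + ρ + e)) := by rw [he]; gcongr
      _ = (c * κ) * (lam + ρ + e) := by ring
      _ ≤ _ := by gcongr
  have hρ1 : ρ ≤ lam / 4 := by nlinarith
  have he2 : e ≤ α * lam * (5 / 28) := by nlinarith
  have hsum : (2 - α) * (ρ + e) ≤ α * lam := by nlinarith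
  -- Dual feasibility: irrepresentability transports the bound from `S` with factor `1 - α`, and `(1
  -- - α)(lam + ρ + e) + ρ + e = (1 - α) lam + (2 - α)(ρ + e) ≤ lam`.
  have hoff : ∀ i, i ∉ S → |(A *ᵥ θ - b) i| ≤ lam := by
    intro i hi
    have h3 : (A₀ *ᵥ Δ) i = ((subMat A₀ Sᶜ S * (subMat A₀ S S)⁻¹) *ᵥ w) ⟨i, hi⟩ := by
      rw [← mulVec_mulVec, hsol]
      exact (submatrix_mulVec_of_supported A₀ hΔS ⟨i, hi⟩).symm
    have h4 : |(A₀ *ᵥ Δ) i| ≤ (1 - α) * (lam + ρ + e) := by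
      rw [h3]
      refine (abs_mulVec_le_rowSumNorm_mul _ hs0 hwb _).trans ?_
      gcongr
    have h5 : (A *ᵥ θ - b) i = (A₀ *ᵥ Δ) i - ((b - b₀) i - ((A - A₀) *ᵥ θ₀) i) +
        ((A - A₀) *ᵥ Δ) i := by rw [hid]; ring
    rw [h5]
    refine (abs_add_le _ _).trans ((add_le_add (abs_sub _ _) le_rfl).trans ?_)
    linarith [hρ i, hE i]
  obtain ⟨hmin, huniq⟩ := quadLoss_le_of_firstOrder hA (θ := θ) (b := b) (lam := lam)
    (fun i => if hi : i ∈ S then (hfo i hi).1 else hoff i hi)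
    (fun i => if hi : i ∈ S then (hfo i hi).2 else by simp [hθS i hi])
  refine ⟨θ, hθS, fun i => ((hV i).trans hVle).trans ?_, hmin, huniq⟩
  rw [div_mul_eq_mul_div, le_div_iff₀ (by linarith)]
  have : (2 - α) * (lam + ρ + e) ≤ 2 * lam := by nlinarith
  nlinarith

end Quadratic

end TruncGGM

/-! ### From entrywise bounds to the conclusion of the theorem -/

namespace TruncGGM

theorem sum_abs_le_mul_ncard {ι : Type*} [Fintype ι] {v : ι → ℝ} {S : Set ι} {B : ℝ}
    (hS : ∀ i, i ∉ S → v i = 0) (hv : ∀ i, |v i| ≤ B) : ∑ i, |v i| ≤ B * S.ncard := by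
  classical
  have h : ∑ i, |v i| = ∑ i ∈ S.toFinset, |v i| := by
    refine (Finset.sum_subset (Finset.subset_univ _) fun i _ hi => ?_).symm
    rw [hS i (by simpa using hi), abs_zero]
  rw [h, ncard_eq_toFinset_card', mul_comm, ← nsmul_eq_mul]
  exact Finset.sum_le_card_nsmul _ _ _ fun i _ => hv i

theorem sqrt_sum_sq_le_mul_sqrt_ncard {ι : Type*} [Fintype ι] {v : ι → ℝ} {S : Set ι} {B : ℝ}
    (hB : 0 ≤ B) (hS : ∀ i, i ∉ S → v i = 0) (hv : ∀ i, |v i| ≤ B) :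
    Real.sqrt (∑ i, v i ^ 2) ≤ B * Real.sqrt S.ncard := by
  have h := sum_abs_le_mul_ncard (v := fun i => v i ^ 2) (B := B ^ 2)
    (fun i hi => by rw [hS i hi]; simp) (fun i => by
      rw [abs_pow]; exact pow_le_pow_left₀ (abs_nonneg _) (hv i) 2) (S := S)
  simp only [abs_pow, sq_abs] at h
  refine (Real.sqrt_le_sqrt h).trans_eq ?_
  rw [Real.sqrt_mul (sq_nonneg B), Real.sqrt_sq hB]

theorem specNorm_le_of_sum_sq_le {m : ℕ} (A : Matrix (Fin m) (Fin m) ℝ) {R : ℝ} (hR : 0 ≤ R)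
    (h : ∀ x : Fin m → ℝ, ∑ i, (A *ᵥ x) i ^ 2 ≤ R ^ 2 * ∑ i, x i ^ 2) : specNorm A ≤ R := by
  refine ContinuousLinearMap.opNorm_le_bound _ hR fun x => ?_
  rw [EuclideanSpace.norm_eq, EuclideanSpace.norm_eq]
  refine (Real.sqrt_le_left (by positivity)).2 ?_
  rw [mul_pow, Real.sq_sqrt (Finset.sum_nonneg fun _ _ => sq_nonneg _)]
  simp only [Real.norm_eq_abs, sq_abs]
  exact h x

theorem specNorm_le_frobNorm {m : ℕ} (A : Matrix (Fin m) (Fin m) ℝ) :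
    specNorm A ≤ frobNorm A := by
  refine specNorm_le_of_sum_sq_le A (Real.sqrt_nonneg _) fun x => ?_
  have h : 0 ≤ ∑ i, ∑ j, A i j ^ 2 :=
    Finset.sum_nonneg fun _ _ => Finset.sum_nonneg fun _ _ => sq_nonneg _
  rw [frobNorm, Real.sq_sqrt h, Finset.sum_mul]
  exact Finset.sum_le_sum fun i _ =>
    Finset.sum_mul_sq_le_sq_mul_sq Finset.univ (fun j => A i j) x

/-- The Schur test. -/
theorem specNorm_le_of_row_col_sum_le {m : ℕ} (A : Matrix (Fin m) (Fin m) ℝ) {R : ℝ} (hR : 0 ≤ R)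
    (hrow : ∀ i, ∑ j, |A i j| ≤ R) (hcol : ∀ j, ∑ i, |A i j| ≤ R) : specNorm A ≤ R := by
  refine specNorm_le_of_sum_sq_le A hR fun x => ?_
  have h1 : ∀ i, (A *ᵥ x) i ^ 2 ≤ R * ∑ j, |A i j| * x j ^ 2 := by
    intro i
    have h2 := Finset.sum_sq_le_sum_mul_sum_of_sq_le_mul Finset.univ (r := fun j => A i j * x j)
      (f := fun j => |A i j|) (g := fun j => |A i j| * x j ^ 2) (fun _ _ => abs_nonneg _)
      (fun _ _ => by positivity) (fun j _ => by
        rw [mul_pow, ← mul_assoc, abs_mul_abs_self, sq (A i j)])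
    refine h2.trans ?_
    gcongr
    exact hrow i
  calc ∑ i, (A *ᵥ x) i ^ 2 ≤ ∑ i, R * ∑ j, |A i j| * x j ^ 2 :=
        Finset.sum_le_sum fun i _ => h1 i
    _ = R * ∑ j, (∑ i, |A i j|) * x j ^ 2 := by
        rw [← Finset.mul_sum, Finset.sum_comm]
        simp only [Finset.sum_mul]
    _ ≤ R * ∑ j, R * x j ^ 2 := by
        gcongr with j; exact hcol j
    _ = _ := by rw [← Finset.mul_sum]; ring

theorem sign_eq_of_abs_sub_le {x y B : ℝ} (h : |x - y| ≤ B) (hy : B < |y|) :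
    SignType.sign x = SignType.sign y ∧ x ≠ 0 := by
  have h1 := abs_le.1 h
  rcases lt_abs.1 hy with h2 | h2
  · have hx : 0 < x := by linarith
    have hy : 0 < y := by linarith [(abs_nonneg _).trans h]
    exact ⟨by rw [sign_pos hx, sign_pos hy], hx.ne'⟩
  · have hx : x < 0 := by linarith
    have hy : y < 0 := by linarith [(abs_nonneg _).trans h]
    exact ⟨by rw [sign_neg hx, sign_neg hy], hx.ne⟩

theorem ncard_col_le_maxColCount {ι κ : Type*} [Fintype ι] [Fintype κ] (A : Matrix ι κ ℝ) (j : κ) :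
    {i : ι | A i j ≠ 0}.ncard ≤ maxColCount A :=
  Finset.le_sup (f := fun j : κ => {i : ι | A i j ≠ 0}.ncard) (Finset.mem_univ j)

/-- The error lives on `S₀` with entries at most `B`, so every norm bound is a count of non-zeros.
The estimate need not be symmetric, but the pattern of `K₀` is, so row sums as well as column sums
involve at most `d` terms. -/
theorem goodEstimate_of_entrywise {n m : ℕ} {h : Fin m → ℝ → ℝ} {δ lam : ℝ}
    {x : Matrix (Fin n) (Fin m) ℝ} {K₀ : Matrix (Fin m) (Fin m) ℝ} (hK₀ : K₀ᵀ = K₀)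
    {η₀ : Fin m → ℝ} {B : ℝ} (hB : 0 ≤ B) {Ψ : Matrix (Fin m ⊕ Unit) (Fin m) ℝ}
    (hmin : IsEstimator h δ lam x Ψ) (huniq : ∀ Φ, IsEstimator h δ lam x Φ → Φ = Ψ)
    (hsupp : supp Ψ ⊆ supp (mkPsi K₀ η₀)) (hent : ∀ a j, |Ψ a j - mkPsi K₀ η₀ a j| ≤ B) :
    GoodEstimate h δ lam x K₀ η₀ B Ψ := by
  have hzero : ∀ a j, mkPsi K₀ η₀ a j = 0 → Ψ a j = 0 := fun a j h0 => by
    by_contra hne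
    exact hsupp (show (a, j) ∈ supp Ψ from hne) h0
  have hmaxK : ∀ k j, |(partK Ψ - K₀) k j| ≤ B := fun k j => hent (Sum.inl k) j
  have hmaxη : ∀ j, |(partEta Ψ - η₀) j| ≤ B := fun j => hent (Sum.inr ()) j
  have hK0 : ∀ k j, K₀ k j = 0 → (partK Ψ - K₀) k j = 0 := fun k j h0 => by
    have : partK Ψ k j = 0 := hzero (Sum.inl k) j h0
    rw [Matrix.sub_apply, this, h0, sub_zero]
  have hη0 : ∀ j, η₀ j = 0 → (partEta Ψ - η₀) j = 0 := fun j h0 => by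
    have : partEta Ψ j = 0 := hzero (Sum.inr ()) j h0
    rw [Pi.sub_apply, this, h0, sub_zero]
  have hcardK : (supp K₀).ncard ≤ (supp (mkPsi K₀ η₀)).ncard :=
    ncard_le_ncard_of_injOn (fun p => (Sum.inl p.1, p.2)) (fun p hp => hp)
      (fun p _ q _ hpq => by
        simp only [Prod.mk.injEq, Sum.inl.injEq] at hpq
        exact Prod.ext hpq.1 hpq.2) (toFinite _)
  have hcardη : {j | η₀ j ≠ 0}.ncard ≤ (supp (mkPsi K₀ η₀)).ncard :=
    ncard_le_ncard_of_injOn (fun j => (Sum.inr (), j)) (fun p hp => hp)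
      (fun p _ q _ hpq => by
        simp only [Prod.mk.injEq] at hpq
        exact hpq.2) (toFinite _)
  have hfrobK : frobNorm (partK Ψ - K₀) ≤ B * Real.sqrt (supp (mkPsi K₀ η₀)).ncard := by
    have h1 := sqrt_sum_sq_le_mul_sqrt_ncard hB (S := supp K₀)
      (v := fun p : Fin m × Fin m => (partK Ψ - K₀) p.1 p.2)
      (fun p hp => hK0 _ _ (by simpa [supp] using hp)) (fun p => hmaxK _ _)
    rw [Fintype.sum_prod_type] at h1
    refine h1.trans ?_
    gcongr
  have hspecη : euclNorm (partEta Ψ - η₀) ≤ B * Real.sqrt {j | η₀ j ≠ 0}.ncard :=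
    sqrt_sum_sq_le_mul_sqrt_ncard hB (fun j hj => hη0 j (by simpa using hj)) hmaxη
  have hcolsupp : ∀ j, {k | K₀ k j ≠ 0}.ncard ≤ maxColCount (mkPsi K₀ η₀) := fun j => by
    refine le_trans ?_ (ncard_col_le_maxColCount (mkPsi K₀ η₀) j)
    exact ncard_le_ncard_of_injOn Sum.inl (fun k hk => hk) Sum.inl_injective.injOn (toFinite _)
  have hcol : ∀ j, ∑ k, |(partK Ψ - K₀) k j| ≤ B * maxColCount (mkPsi K₀ η₀) := fun j => by
    refine (sum_abs_le_mul_ncard (S := {k | K₀ k j ≠ 0})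
      (fun k hk => hK0 k j (by simpa using hk)) (fun k => hmaxK k j)).trans ?_
    gcongr
    exact hcolsupp j
  have hrow : ∀ k, ∑ j, |(partK Ψ - K₀) k j| ≤ B * maxColCount (mkPsi K₀ η₀) := fun k => by
    refine (sum_abs_le_mul_ncard (S := {j | K₀ j k ≠ 0})
      (fun j hj => hK0 k j ?_) (fun j => hmaxK k j)).trans ?_
    · rw [← hK₀]; simpa using hj
    · gcongr
      exact hcolsupp k
  refine
    { minimizes := hmin
      unique := huniq
      supp_subset := hsupp
      max_K := hmaxK
      max_eta := hmaxη
      frob_K := hfrobK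
      frob_eta := hspecη.trans (by gcongr)
      spec_K := ?_
      spec_eta := hspecη
      sign_recovery := fun hK hη => ?_ }
  · rw [mul_min_of_nonneg _ _ hB]
    exact le_min ((specNorm_le_frobNorm _).trans hfrobK)
      (specNorm_le_of_row_col_sum_le _ (by positivity) hrow hcol)
  · refine ⟨hsupp.antisymm ?_, fun k j hkj => (sign_eq_of_abs_sub_le (hmaxK k j) (hK k j hkj)).1,
      fun j hj => (sign_eq_of_abs_sub_le (hmaxη j) (hη j hj)).1⟩
    rintro ⟨k | ⟨⟩, j⟩ hp
    · exact (sign_eq_of_abs_sub_le (hmaxK k j) (hK k j hp)).2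
    · exact (sign_eq_of_abs_sub_le (hmaxη j) (hη j hp)).2

end TruncGGM

/-! ### The structure of the score matching loss -/

namespace TruncGGM

theorem cGamma_nonneg {ι : Type*} [Fintype ι] (A : Matrix ι ι ℝ) (S : Set ι) : 0 ≤ cGamma A S := by
  classical exact rowSumNorm_nonneg _

theorem loss_eq_quadLoss {n m : ℕ} (h : Fin m → ℝ → ℝ) (δ lam : ℝ) (x : Matrix (Fin n) (Fin m) ℝ)
    (Ψ : Matrix (Fin m ⊕ Unit) (Fin m) ℝ) :
    loss h δ lam x Ψ = quadLoss (gammaAmp h δ x) (gVec h x) lam (vecPsi Ψ) := by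
  rw [loss, quadLoss, Fintype.sum_prod_type]
  rfl

/-- The contribution of one observation to an entry of a diagonal block of `Γ(x)`. -/
noncomputable def gammaTerm {m : ℕ} (h : Fin m → ℝ → ℝ) (j : Fin m) (a b : Fin m ⊕ Unit)
    (x : Fin m → ℝ) : ℝ :=
  h j (x j) * extVec x a * extVec x b

/-- The contribution of one observation to an entry of `g(x)`. -/
noncomputable def scoreTerm {m : ℕ} (h : Fin m → ℝ → ℝ) (j : Fin m) (a : Fin m ⊕ Unit)
    (x : Fin m → ℝ) : ℝ :=
  deriv (h j) (x j) * extVec x a + (if a = Sum.inl j then 1 else 0) * h j (x j)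

theorem gammaBlock_apply {n m : ℕ} (h : Fin m → ℝ → ℝ) (x : Matrix (Fin n) (Fin m) ℝ) (j : Fin m)
    (a b : Fin m ⊕ Unit) :
    gammaBlock h x j a b = (n : ℝ)⁻¹ * ∑ i, gammaTerm h j a b (x i) := by
  rw [gammaBlock, Matrix.smul_apply, smul_eq_mul]
  congr 1
  rcases a with k | u <;> rcases b with l | v
  · rw [fromBlocks_apply₁₁, mul_apply]
    simp only [mul_diagonal, transpose_apply, gammaTerm, extVec, Sum.elim_inl]
    exact Finset.sum_congr rfl fun i _ => by ring
  · simp only [fromBlocks_apply₁₂, Matrix.neg_apply, replicateCol_apply, mulVec, dotProduct,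
      transpose_apply, gammaTerm, extVec, Sum.elim_inl, Sum.elim_inr, ← Finset.sum_neg_distrib]
    exact Finset.sum_congr rfl fun i _ => by ring
  · simp only [fromBlocks_apply₂₁, Matrix.neg_apply, replicateRow_apply, mulVec, dotProduct,
      transpose_apply, gammaTerm, extVec, Sum.elim_inl, Sum.elim_inr, ← Finset.sum_neg_distrib]
    exact Finset.sum_congr rfl fun i _ => by ring
  · simp [gammaTerm, extVec]

theorem gammaMat_apply {n m : ℕ} (h : Fin m → ℝ → ℝ) (x : Matrix (Fin n) (Fin m) ℝ)
    (p q : (Fin m ⊕ Unit) × Fin m) :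
    gammaMat h x p q =
      if p.2 = q.2 then (n : ℝ)⁻¹ * ∑ i, gammaTerm h p.2 p.1 q.1 (x i) else 0 := by
  rw [gammaMat, blockDiagonal_apply, gammaBlock_apply]

theorem gVec_apply {n m : ℕ} (h : Fin m → ℝ → ℝ) (x : Matrix (Fin n) (Fin m) ℝ)
    (p : (Fin m ⊕ Unit) × Fin m) :
    gVec h x p = (n : ℝ)⁻¹ * ∑ i, scoreTerm h p.2 p.1 (x i) := by
  obtain ⟨k | u, j⟩ := p
  · simp [gVec, scoreTerm, extVec]
  · simp [gVec, scoreTerm, extVec]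

/-- Each block averages rank-one matrices weighted by `h_j`, so the form is a weighted sum of
squares. -/
theorem dotProduct_gammaMat_mulVec {n m : ℕ} (h : Fin m → ℝ → ℝ) (x : Matrix (Fin n) (Fin m) ℝ)
    (v : (Fin m ⊕ Unit) × Fin m → ℝ) :
    v ⬝ᵥ (gammaMat h x *ᵥ v) =
      (n : ℝ)⁻¹ * ∑ i, ∑ j, h j (x i j) * (∑ a, extVec (x i) a * v (a, j)) ^ 2 := by
  have h1 : ∀ a j, (gammaMat h x *ᵥ v) (a, j) =
      (n : ℝ)⁻¹ * ∑ i, h j (x i j) * extVec (x i) a * ∑ b, extVec (x i) b * v (b, j) := by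
    intro a j
    simp only [mulVec, dotProduct, Fintype.sum_prod_type, gammaMat_apply, ite_mul, zero_mul,
      Finset.sum_ite_eq, Finset.mem_univ, if_true]
    simp only [mul_assoc, ← Finset.mul_sum, Finset.sum_mul]
    congr 1
    rw [Finset.sum_comm]
    refine Finset.sum_congr rfl fun i _ => ?_
    simp only [Finset.mul_sum]
    exact Finset.sum_congr rfl fun b _ => by rw [gammaTerm]; ring
  simp only [dotProduct, Fintype.sum_prod_type, h1]
  rw [Finset.sum_comm, Finset.sum_comm (s := Finset.univ (α := Fin n)), Finset.mul_sum]
  refine Finset.sum_congr rfl fun j _ => ?_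
  simp only [Finset.mul_sum]
  rw [Finset.sum_comm]
  refine Finset.sum_congr rfl fun i _ => ?_
  rw [sq, Finset.sum_mul]
  simp only [Finset.mul_sum]
  exact Finset.sum_congr rfl fun a _ => Finset.sum_congr rfl fun b _ => by ring

/-- The amplifier is strictly positive on the `K`-entries. If those vanish, the rank-one sums reduce
to multiples `h_j(x_ij) > 0` of squared `η`-entries, so the latter need no amplification. -/
theorem posDef_gammaAmp {n m : ℕ} (hn : 0 < n) {h : Fin m → ℝ → ℝ} {δ : ℝ} (hδ : 1 < δ)
    {x : Matrix (Fin n) (Fin m) ℝ} (hx : ∀ i j, 0 < x i j) (hh : ∀ i j, 0 < h j (x i j)) :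
    (gammaAmp h δ x).PosDef := by
  have hn' : (0 : ℝ) < n := by exact_mod_cast hn
  have : Nonempty (Fin n) := ⟨⟨0, hn⟩⟩
  have hdiag : ∀ k j, 0 < amplifier h δ x (Sum.inl k, j) := by
    intro k j
    simp only [amplifier, gammaMat_apply, if_true]
    refine mul_pos (by linarith) (mul_pos (inv_pos.2 hn') (Finset.sum_pos (fun i _ => ?_)
      Finset.univ_nonempty))
    exact mul_pos (mul_pos (hh i j) (hx i k)) (hx i k)
  refine PosDef.of_dotProduct_mulVec_pos ?_ fun v hv => ?_
  · refine IsHermitian.ext fun p q => ?_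
    simp only [star_trivial, gammaAmp, Matrix.add_apply, gammaMat_apply]
    congr 1
    · by_cases hpq : p.2 = q.2
      · rw [if_pos hpq, if_pos hpq.symm, hpq]
        congr 1
        exact Finset.sum_congr rfl fun i _ => by rw [gammaTerm, gammaTerm]; ring
      · rw [if_neg hpq, if_neg (Ne.symm hpq)]
    · by_cases hpq : p = q
      · rw [hpq]
      · rw [diagonal_apply_ne _ hpq, diagonal_apply_ne _ (Ne.symm hpq)]
  · rw [star_trivial, gammaAmp, add_mulVec, dotProduct_add, dotProduct_gammaMat_mulVec]
    have h1 : 0 ≤ (n : ℝ)⁻¹ * ∑ i, ∑ j, h j (x i j) * (∑ a, extVec (x i) a * v (a, j)) ^ 2 :=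
      mul_nonneg (inv_nonneg.2 hn'.le) (Finset.sum_nonneg fun i _ => Finset.sum_nonneg fun j _ =>
        mul_nonneg (hh i j).le (sq_nonneg _))
    have h2 : v ⬝ᵥ (diagonal (amplifier h δ x) *ᵥ v) = ∑ p, amplifier h δ x p * v p ^ 2 := by
      simp only [mulVec_diagonal, dotProduct]
      exact Finset.sum_congr rfl fun p _ => by ring
    have hampnn : ∀ p, 0 ≤ amplifier h δ x p * v p ^ 2 := by
      rintro ⟨k | u, j⟩
      · exact mul_nonneg (hdiag k j).le (sq_nonneg _)
      · simp [amplifier]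
    rw [h2]
    by_cases hK : ∃ k j, v (Sum.inl k, j) ≠ 0
    · obtain ⟨k, j, hkj⟩ := hK
      refine add_pos_of_nonneg_of_pos h1 (Finset.sum_pos' (fun p _ => hampnn p)
        ⟨(Sum.inl k, j), Finset.mem_univ _, mul_pos (hdiag k j) (by positivity)⟩)
    · push Not at hK
      obtain ⟨j, hj⟩ : ∃ j, v (Sum.inr (), j) ≠ 0 := by
        by_contra! hcon
        refine hv (funext ?_)
        rintro ⟨k | ⟨⟩, j⟩
        · exact hK k j
        · exact hcon j
      refine add_pos_of_pos_of_nonneg ?_ (Finset.sum_nonneg fun p _ => hampnn p)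
      refine mul_pos (inv_pos.2 hn') (Finset.sum_pos (fun i _ => ?_) Finset.univ_nonempty)
      refine Finset.sum_pos' (fun j _ => mul_nonneg (hh i j).le (sq_nonneg _))
        ⟨j, Finset.mem_univ _, mul_pos (hh i j) ?_⟩
      have : ∑ a, extVec (x i) a * v (a, j) = -v (Sum.inr (), j) := by
        simp [Fintype.sum_sum_type, hK, extVec]
      rw [this, neg_sq]
      positivity

/-- A deterministic error bound for the regularized score matching estimator. -/
theorem exists_goodEstimate_of_abs_sub_le {n m : ℕ} (hn : 0 < n) {h : Fin m → ℝ → ℝ} {δ lam : ℝ}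
    (hδ : 1 < δ) (hlam : 0 < lam) {x : Matrix (Fin n) (Fin m) ℝ}
    (hx : ∀ i j, 0 < x i j) (hh : ∀ i j, 0 < h j (x i j))
    {K₀ : Matrix (Fin m) (Fin m) ℝ} (hK₀ : K₀ᵀ = K₀) {η₀ : Fin m → ℝ}
    {G₀ : Matrix ((Fin m ⊕ Unit) × Fin m) ((Fin m ⊕ Unit) × Fin m) ℝ}
    (hG₀ : ∀ p q, p.2 ≠ q.2 → G₀ p q = 0) {g₀ : (Fin m ⊕ Unit) × Fin m → ℝ}
    (hpop : G₀ *ᵥ vecPsi (mkPsi K₀ η₀) = g₀) {α ε₁ ε₂ : ℝ} (hα : 0 < α) (hα₁ : α ≤ 1)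
    (hirr : Irrepresentable G₀ (supp (mkPsi K₀ η₀)) α) (hε₁ : 0 ≤ ε₁)
    (hG : ∀ p q, p.2 = q.2 → |gammaAmp h δ x p q - G₀ p q| ≤ ε₁)
    (hg : ∀ p, |gVec h x p - g₀ p| ≤ ε₂)
    (h₁ : cGamma G₀ (supp (mkPsi K₀ η₀)) * (ε₁ * maxColCount (mkPsi K₀ η₀)) ≤ α / 8)
    (h₂ : (2 - α) * (ε₂ + ε₁ * rowSumNorm (mkPsi K₀ η₀)ᵀ) ≤ α * lam / 4) :
    ∃ Ψ, GoodEstimate h δ lam x K₀ η₀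
      (2 * cGamma G₀ (supp (mkPsi K₀ η₀)) / (2 - α) * lam) Ψ := by
  set Ψ₀ := mkPsi K₀ η₀ with hΨ₀
  have hPD := posDef_gammaAmp hn hδ hx hh
  have hoff : ∀ p q, p.2 ≠ q.2 → (gammaAmp h δ x - G₀) p q = 0 := by
    intro p q hpq
    have : p ≠ q := fun h => hpq (h ▸ rfl)
    simp [gammaAmp, gammaMat_apply, hpq, hG₀ p q hpq, this]
  -- Only column `p.2` of the parameter enters row `p`; hence the column quantities `d` and `c_Ψ`
  -- instead of `|S₀|` and a full `ℓ1` norm.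
  have hmul : ∀ (v : (Fin m ⊕ Unit) × Fin m → ℝ) p,
      |((gammaAmp h δ x - G₀) *ᵥ v) p| ≤ ε₁ * ∑ a, |v (a, p.2)| := by
    intro v p
    have h3 : ((gammaAmp h δ x - G₀) *ᵥ v) p =
        ∑ a, (gammaAmp h δ x - G₀) p (a, p.2) * v (a, p.2) := by
      simp only [mulVec, dotProduct, Fintype.sum_prod_type]
      refine Finset.sum_congr rfl fun a _ => Finset.sum_eq_single _ (fun j _ hj => ?_) (by simp)
      rw [hoff p (a, j) (Ne.symm hj), zero_mul]
    rw [h3, Finset.mul_sum]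
    refine (Finset.abs_sum_le_sum_abs _ _).trans (Finset.sum_le_sum fun a _ => ?_)
    rw [abs_mul]
    gcongr
    exact hG p (a, p.2) rfl
  obtain ⟨θ, hθS, hθB, hmin, huniq⟩ := exists_minimizer_of_irrepresentable hPD (b := gVec h x)
    (S := supp Ψ₀) (θ₀ := vecPsi Ψ₀) (fun p hp => by simpa [supp, vecPsi] using hp) hpop hα hα₁ hlam
    (κ := ε₁ * maxColCount Ψ₀) (ρ := ε₂ + ε₁ * rowSumNorm Ψ₀ᵀ) (by positivity) hirr
    (fun v V hV hvS hvV p => by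
      refine (hmul v p).trans ?_
      rw [mul_assoc]
      gcongr
      rw [mul_comm]
      refine (sum_abs_le_mul_ncard (v := fun a => v (a, p.2)) (S := {a | Ψ₀ a p.2 ≠ 0})
        (fun a ha => hvS _ ha) (fun a => hvV _)).trans ?_
      gcongr
      exact ncard_col_le_maxColCount Ψ₀ p.2)
    (fun p => by
      refine (abs_sub _ _).trans (add_le_add (hg p) ((hmul _ p).trans ?_))
      gcongr
      exact row_sum_le_rowSumNorm Ψ₀ᵀ p.2)
    h₁ h₂
  have hθv : vecPsi (Matrix.of fun a j => θ (a, j)) = θ := rfl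
  have hBnn : 0 ≤ 2 * cGamma G₀ (supp Ψ₀) / (2 - α) * lam :=
    mul_nonneg (div_nonneg (mul_nonneg zero_le_two (cGamma_nonneg _ _)) (by linarith)) hlam.le
  refine ⟨Matrix.of fun a j => θ (a, j), goodEstimate_of_entrywise hK₀ hBnn (fun Φ => ?_)
    (fun Φ hΦ => ?_) (fun p hp => ?_) (fun a j => hθB (a, j))⟩
  · rw [loss_eq_quadLoss, loss_eq_quadLoss, hθv]
    exact hmin _
  · have h3 := hΦ (Matrix.of fun a j => θ (a, j))
    rw [loss_eq_quadLoss, loss_eq_quadLoss, hθv] at h3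
    have h4 := huniq _ h3
    ext a j
    exact congrFun h4 (a, j)
  · by_contra hcon
    exact hp (hθS p hcon)

end TruncGGM

/-! ### Sub-exponential tails of the entries of the loss -/

namespace TruncGGM

/-! ### Regularity and almost sure bounds of the weights. -/

section Weights

variable {m : ℕ} {h : Fin m → ℝ → ℝ}

theorem MemH11.continuousOn_Ici (hh : MemH11 h) (j : Fin m) : ContinuousOn (h j) (Ici 0) := by
  intro s hs
  have h1 := (hh.absCont j 0 (s + 1) le_rfl (by linarith [mem_Ici.1 hs])).continuousOn
  rw [uIcc_of_le (by linarith [mem_Ici.1 hs])] at h1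
  refine (h1 s ⟨hs, by linarith⟩).mono_of_mem_nhdsWithin ?_
  rw [← Ici_inter_Iic]
  exact inter_mem self_mem_nhdsWithin (mem_nhdsWithin_of_mem_nhds (Iic_mem_nhds (by linarith)))

/-- Only the right limit is assumed to vanish; continuity up to `0` turns it into the value needed
for integration by parts. -/
theorem MemH11.apply_zero (hh : MemH11 h) (j : Fin m) : h j 0 = 0 :=
  tendsto_nhds_unique
    ((hh.continuousOn_Ici j 0 self_mem_Ici).mono_left (nhdsWithin_mono 0 Ioi_subset_Ici_self))
    (hh.tendsto_zero j)

variable (μ : Fin m → ℝ) (K : Matrix (Fin m) (Fin m) ℝ)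

theorem MemH11.aemeasurable_eval (hh : MemH11 h) (j : Fin m) :
    AEMeasurable (fun x => h j (x j)) (truncNormal μ K) := by
  refine AEMeasurable.mono_ac ?_ (truncNormal_absolutelyContinuous μ K)
  refine ContinuousOn.aemeasurable ?_ (measurableSet_orthant m)
  exact (hh.continuousOn_Ici j).comp (continuous_apply j).continuousOn fun x hx => hx j

theorem measurable_extVec (a : Fin m ⊕ Unit) : Measurable fun x : Fin m → ℝ => extVec x a := by
  rcases a with k | u
  · exact measurable_pi_apply k
  · exact measurable_const

theorem MemH11.aemeasurable_gammaTerm (hh : MemH11 h) (j : Fin m) (a b : Fin m ⊕ Unit) :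
    AEMeasurable (gammaTerm h j a b) (truncNormal μ K) :=
  ((hh.aemeasurable_eval μ K j).mul (measurable_extVec a).aemeasurable).mul
    (measurable_extVec b).aemeasurable

theorem MemH11.aemeasurable_scoreTerm (hh : MemH11 h) (j : Fin m) (a : Fin m ⊕ Unit) :
    AEMeasurable (scoreTerm h j a) (truncNormal μ K) :=
  (((measurable_deriv (h j)).comp (measurable_pi_apply j)).aemeasurable.mul
    (measurable_extVec a).aemeasurable).add ((hh.aemeasurable_eval μ K j).const_mul _)

/-- The bounds on the weights and their derivatives hold almost surely at the observations. -/
theorem MemH11.ae_bounds (hh : MemH11 h) {M M' : ℝ}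
    (hM : ∀ j, ∀ᵐ x ∂(volume.restrict (Ioi (0 : ℝ))), 0 ≤ h j x ∧ h j x ≤ M)
    (hM' : ∀ j, ∀ᵐ x ∂(volume.restrict (Ioi (0 : ℝ))), 0 ≤ deriv (h j) x ∧ deriv (h j) x ≤ M') :
    ∀ᵐ x ∂(truncNormal μ K), ∀ j, 0 < x j ∧ (0 < h j (x j) ∧ h j (x j) ≤ M) ∧
      0 ≤ deriv (h j) (x j) ∧ deriv (h j) (x j) ≤ M' := by
  rw [ae_all_iff]
  intro j
  filter_upwards [ae_pos_truncNormal μ K, ae_eval_truncNormal μ K (hh.pos j) j,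
    ae_eval_truncNormal μ K (hM j) j, ae_eval_truncNormal μ K (hM' j) j] with x h1 h2 h3 h4
  exact ⟨h1 j, ⟨h2, h3.2⟩, h4⟩

end Weights

/-- The coordinate of the observation in an entry of the extended observation, with default `j`. -/
def coordOr {m : ℕ} (j : Fin m) : Fin m ⊕ Unit → Fin m :=
  Sum.elim id fun _ => j

theorem extVec_sq_le {m : ℕ} (j : Fin m) (a : Fin m ⊕ Unit) (x : Fin m → ℝ) :
    extVec x a ^ 2 ≤ 1 + x (coordOr j a) ^ 2 := by
  rcases a with k | u
  · simp [extVec, coordOr]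
  · simp [extVec]; positivity

theorem abs_gammaTerm_le {m : ℕ} {h : Fin m → ℝ → ℝ} {M c : ℝ} (hc : 1 ≤ c) (j : Fin m)
    (a b : Fin m ⊕ Unit) {x : Fin m → ℝ} (h₀ : 0 < h j (x j)) (h₁ : h j (x j) ≤ M) :
    |gammaTerm h j a b x| ≤
      M * c ^ 2 * (2 + (x (coordOr j a) ^ 2 + x (coordOr j b) ^ 2) / c ^ 2) := by
  have ha := extVec_sq_le j a x
  have hb := extVec_sq_le j b x
  have hab : |extVec x a * extVec x b| ≤ (extVec x a ^ 2 + extVec x b ^ 2) / 2 := by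
    rw [abs_mul, ← sq_abs (extVec x a), ← sq_abs (extVec x b)]
    nlinarith [sq_nonneg (|extVec x a| - |extVec x b|)]
  have hM : 0 < M := h₀.trans_le h₁
  have hc2 : 1 ≤ c ^ 2 := one_le_pow₀ hc
  have h2 : M * c ^ 2 * (2 + (x (coordOr j a) ^ 2 + x (coordOr j b) ^ 2) / c ^ 2) =
      M * (2 * c ^ 2 + (x (coordOr j a) ^ 2 + x (coordOr j b) ^ 2)) := by
    field_simp
  rw [gammaTerm, mul_assoc, abs_mul, abs_of_pos h₀, h2]
  gcongr
  nlinarith [sq_nonneg (x (coordOr j a)), sq_nonneg (x (coordOr j b))]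

/-- The growth is linear, so the scale is `M' c`, not `M' c²`. The coordinate is written twice to
share the quadratic estimate with `abs_gammaTerm_le`. -/
theorem abs_scoreTerm_le {m : ℕ} {h : Fin m → ℝ → ℝ} {M M' c : ℝ} (hc : 1 ≤ c) (j : Fin m)
    (a : Fin m ⊕ Unit) {x : Fin m → ℝ} (h₀ : 0 < h j (x j)) (h₁ : h j (x j) ≤ M)
    (h₂ : 0 ≤ deriv (h j) (x j)) (h₃ : deriv (h j) (x j) ≤ M') :
    |scoreTerm h j a x| ≤
      (M' * c + M) * (2 + (x (coordOr j a) ^ 2 + x (coordOr j a) ^ 2) / c ^ 2) := by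
  have ha := extVec_sq_le j a x
  have hM : 0 < M := h₀.trans_le h₁
  have hM' : 0 ≤ M' := h₂.trans h₃
  have hc0 : 0 < c := by linarith
  set q := (x (coordOr j a) ^ 2 + x (coordOr j a) ^ 2) / c ^ 2 with hq
  have hq0 : 0 ≤ q := by positivity
  have hqc : 2 * x (coordOr j a) ^ 2 = q * c ^ 2 := by rw [hq]; field_simp; ring
  have h4 : |extVec x a| ≤ c * (2 + q) := by
    refine abs_le_of_sq_le_sq ?_ (by positivity)
    nlinarith [mul_nonneg hq0 (sq_nonneg c), mul_nonneg (mul_nonneg hq0 hq0) (sq_nonneg c)]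
  have h5 : |(if a = Sum.inl j then (1 : ℝ) else 0) * h j (x j)| ≤ M := by
    split_ifs
    · rwa [one_mul, abs_of_pos h₀]
    · simpa using hM.le
  calc |scoreTerm h j a x| ≤ |deriv (h j) (x j) * extVec x a| +
        |(if a = Sum.inl j then (1 : ℝ) else 0) * h j (x j)| := abs_add_le _ _
    _ ≤ M' * (c * (2 + q)) + M := by
        rw [abs_mul, abs_of_nonneg h₂]; gcongr
    _ ≤ _ := by nlinarith

/-- The scale `16e²b₀` turns the quadratic part into the exponent of
`lintegral_exp_sq_add_sq_le_two`, and the constant part into `1/(4e²) ≤ 1`, which costs a factor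
`e`. -/
theorem lintegral_exp_abs_le_of_abs_le_quadratic {m : ℕ} (μ : Fin m → ℝ)
    {K : Matrix (Fin m) (Fin m) ℝ} (hK : K.PosDef) [IsProbabilityMeasure (truncNormal μ K)]
    {w : (Fin m → ℝ) → ℝ} {c b₀ : ℝ} (hc : 0 < c)
    (hcX : cX μ K ≤ c) (hb₀ : 0 < b₀) {k l : Fin m}
    (hw : ∀ᵐ x ∂(truncNormal μ K), |w x| ≤ b₀ * (2 + (x k ^ 2 + x l ^ 2) / c ^ 2)) :
    ∫⁻ x, ENNReal.ofReal (Real.exp (2 * |w x| / (16 * Real.exp 2 * b₀))) ∂(truncNormal μ K) ≤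
      ENNReal.ofReal (2 * Real.exp 1) := by
  have h1 : (1 : ℝ) ≤ Real.exp 2 := Real.one_le_exp (by norm_num)
  calc _ ≤ ∫⁻ x, ENNReal.ofReal (Real.exp 1) *
        ENNReal.ofReal (Real.exp ((x k ^ 2 + x l ^ 2) / (8 * Real.exp 2 * c ^ 2)))
        ∂(truncNormal μ K) := by
        refine lintegral_mono_ae ?_
        filter_upwards [hw] with x hx
        rw [← ENNReal.ofReal_mul (Real.exp_pos _).le, ← Real.exp_add]
        refine ENNReal.ofReal_le_ofReal (Real.exp_le_exp.2 ?_)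
        calc 2 * |w x| / (16 * Real.exp 2 * b₀)
            ≤ 2 * (b₀ * (2 + (x k ^ 2 + x l ^ 2) / c ^ 2)) / (16 * Real.exp 2 * b₀) := by gcongr
          _ = 1 / (4 * Real.exp 2) + (x k ^ 2 + x l ^ 2) / (8 * Real.exp 2 * c ^ 2) := by
            field_simp; ring
          _ ≤ _ := by
            gcongr
            rw [div_le_one (by positivity)]
            linarith
    _ = ENNReal.ofReal (Real.exp 1) *
        ∫⁻ x, ENNReal.ofReal (Real.exp ((x k ^ 2 + x l ^ 2) / (8 * Real.exp 2 * c ^ 2)))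
        ∂(truncNormal μ K) := lintegral_const_mul' _ _ ENNReal.ofReal_ne_top
    _ ≤ ENNReal.ofReal (Real.exp 1) * 2 := by
        gcongr
        exact lintegral_exp_sq_add_sq_le_two μ hK hc hcX k l
    _ = _ := by
        rw [mul_comm 2, ENNReal.ofReal_mul (Real.exp_pos _).le]; simp

/-- The standing assumptions on the weights and the truncated normal distribution. -/
structure WeightSetting {m : ℕ} (μ : Fin m → ℝ) (K : Matrix (Fin m) (Fin m) ℝ)
    (h : Fin m → ℝ → ℝ) (M M' c : ℝ) : Prop where
  posDef : K.PosDef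
  prob : IsProbabilityMeasure (truncNormal μ K)
  mem : MemH11 h
  bound : ∀ j, ∀ᵐ x ∂(volume.restrict (Ioi (0 : ℝ))), 0 ≤ h j x ∧ h j x ≤ M
  bound_deriv : ∀ j, ∀ᵐ x ∂(volume.restrict (Ioi (0 : ℝ))),
    0 ≤ deriv (h j) x ∧ deriv (h j) x ≤ M'
  one_le : 1 ≤ c
  cX_le : cX μ K ≤ c

namespace WeightSetting

variable {m : ℕ} {μ : Fin m → ℝ} {K : Matrix (Fin m) (Fin m) ℝ} {h : Fin m → ℝ → ℝ} {M M' c : ℝ}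

theorem ae_bounds (H : WeightSetting μ K h M M' c) :
    ∀ᵐ x ∂(truncNormal μ K), ∀ j, 0 < x j ∧ (0 < h j (x j) ∧ h j (x j) ≤ M) ∧
      0 ≤ deriv (h j) (x j) ∧ deriv (h j) (x j) ≤ M' :=
  H.mem.ae_bounds μ K H.bound H.bound_deriv

theorem bounds_pos (H : WeightSetting μ K h M M' c) (j : Fin m) : 0 < M ∧ 0 ≤ M' := by
  have := H.prob
  obtain ⟨x, hx⟩ := H.ae_bounds.exists
  obtain ⟨-, ⟨h1, h2⟩, h3, h4⟩ := hx j
  exact ⟨h1.trans_le h2, h3.trans h4⟩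

theorem lintegral_exp_gammaTerm_le (H : WeightSetting μ K h M M' c) (j : Fin m)
    (a b : Fin m ⊕ Unit) :
    ∫⁻ x, ENNReal.ofReal (Real.exp (2 * |gammaTerm h j a b x| /
      (16 * Real.exp 2 * (M * c ^ 2)))) ∂(truncNormal μ K) ≤ ENNReal.ofReal (2 * Real.exp 1) := by
  have := H.prob
  have hc : 0 < c := by linarith [H.one_le]
  have hM := (H.bounds_pos j).1
  refine lintegral_exp_abs_le_of_abs_le_quadratic μ H.posDef hc H.cX_le (by positivity)
    (k := coordOr j a) (l := coordOr j b) ?_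
  filter_upwards [H.ae_bounds] with x hx
  exact abs_gammaTerm_le H.one_le j a b (hx j).2.1.1 (hx j).2.1.2

theorem lintegral_exp_scoreTerm_le (H : WeightSetting μ K h M M' c) (j : Fin m)
    (a : Fin m ⊕ Unit) :
    ∫⁻ x, ENNReal.ofReal (Real.exp (2 * |scoreTerm h j a x| /
      (16 * Real.exp 2 * (M' * c + M)))) ∂(truncNormal μ K) ≤ ENNReal.ofReal (2 * Real.exp 1) := by
  have := H.prob
  have hc : 0 < c := by linarith [H.one_le]
  obtain ⟨hM, hM'⟩ := H.bounds_pos j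
  refine lintegral_exp_abs_le_of_abs_le_quadratic μ H.posDef hc H.cX_le (by positivity)
    (k := coordOr j a) (l := coordOr j a) ?_
  filter_upwards [H.ae_bounds] with x hx
  exact abs_scoreTerm_le H.one_le j a (hx j).2.1.1 (hx j).2.1.2 (hx j).2.2.1 (hx j).2.2.2

theorem integrable_gammaTerm (H : WeightSetting μ K h M M' c) (j : Fin m) (a b : Fin m ⊕ Unit) :
    Integrable (gammaTerm h j a b) (truncNormal μ K) := by
  have hc : 0 < c := by linarith [H.one_le]
  have hM := (H.bounds_pos j).1
  exact (integrable_of_lintegral_exp_abs_le (H.mem.aemeasurable_gammaTerm μ K j a b)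
    (by positivity) (H.lintegral_exp_gammaTerm_le j a b)).2

theorem integrable_scoreTerm (H : WeightSetting μ K h M M' c) (j : Fin m) (a : Fin m ⊕ Unit) :
    Integrable (scoreTerm h j a) (truncNormal μ K) := by
  have hc : 0 < c := by linarith [H.one_le]
  obtain ⟨hM, hM'⟩ := H.bounds_pos j
  exact (integrable_of_lintegral_exp_abs_le (H.mem.aemeasurable_scoreTerm μ K j a)
    (by positivity) (H.lintegral_exp_scoreTerm_le j a)).2

/-- Amplification shifts the diagonal by a multiple of itself, so its size must be controlled as
well as its fluctuation. -/
theorem abs_integral_gammaTerm_le (H : WeightSetting μ K h M M' c) (j : Fin m)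
    (a b : Fin m ⊕ Unit) :
    |∫ x, gammaTerm h j a b x ∂(truncNormal μ K)| ≤
      16 * Real.exp 2 * Real.exp 1 * (M * c ^ 2) := by
  have hc : 0 < c := by linarith [H.one_le]
  have hM := (H.bounds_pos j).1
  set s := 16 * Real.exp 2 * (M * c ^ 2) with hs
  have hs0 : 0 < s := by positivity
  have hL := H.lintegral_exp_gammaTerm_le j a b
  have h1 := (integrable_of_lintegral_exp_abs_le (H.mem.aemeasurable_gammaTerm μ K j a b)
    hs0 hL).1
  have h2 := integral_exp_le_of_lintegral_exp_abs_le (by positivity) h1 hL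
  calc |∫ x, gammaTerm h j a b x ∂(truncNormal μ K)|
      ≤ ∫ x, |gammaTerm h j a b x| ∂(truncNormal μ K) := abs_integral_le_integral_abs
    _ ≤ ∫ x, s / 2 * Real.exp (2 * |gammaTerm h j a b x| / s) ∂(truncNormal μ K) := by
        refine integral_mono (H.integrable_gammaTerm j a b).abs (h1.const_mul _) fun x => ?_
        have h3 := Real.add_one_le_exp (2 * |gammaTerm h j a b x| / s)
        calc |gammaTerm h j a b x| = s / 2 * (2 * |gammaTerm h j a b x| / s) := by field_simp
          _ ≤ _ := by gcongr; linarith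
    _ = s / 2 * ∫ x, Real.exp (2 * |gammaTerm h j a b x| / s) ∂(truncNormal μ K) :=
        integral_const_mul _ _
    _ ≤ s / 2 * (2 * Real.exp 1) := by gcongr
    _ = _ := by rw [hs]; ring

/-- The population version of the first-order equation. -/
theorem sum_integral_gammaTerm_mul_eq (H : WeightSetting μ K h M M' c) (j : Fin m)
    (a : Fin m ⊕ Unit) :
    ∑ b, (∫ x, gammaTerm h j a b x ∂(truncNormal μ K)) * mkPsi K (K *ᵥ μ) b j =
      ∫ x, scoreTerm h j a x ∂(truncNormal μ K) := by
  have := H.prob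
  have hKt : Kᵀ = K := by simpa using H.posDef.1.eq
  have hlin : ∀ x : Fin m → ℝ, ∑ b, extVec x b * mkPsi K (K *ᵥ μ) b j = (K *ᵥ (x - μ)) j := by
    intro x
    have h1 : ∀ k, K k j = K j k := fun k => congrFun (congrFun hKt j) k
    rw [mulVec_sub]
    simp [extVec, mkPsi, mulVec, dotProduct, h1, mul_comm, sub_eq_add_neg]
  have hscore : ∀ x, ∑ b, gammaTerm h j a b x * mkPsi K (K *ᵥ μ) b j =
      h j (x j) * extVec x a * (K *ᵥ (x - μ)) j := by
    intro x
    rw [← hlin, Finset.mul_sum]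
    exact Finset.sum_congr rfl fun b _ => by rw [gammaTerm]; ring
  have hint : ∀ b, Integrable (fun x => gammaTerm h j a b x * mkPsi K (K *ᵥ μ) b j)
      (truncNormal μ K) := fun b => (H.integrable_gammaTerm j a b).mul_const _
  calc _ = ∑ b, ∫ x, gammaTerm h j a b x * mkPsi K (K *ᵥ μ) b j ∂(truncNormal μ K) := by
        simp only [integral_mul_const]
    _ = ∫ x, ∑ b, gammaTerm h j a b x * mkPsi K (K *ᵥ μ) b j ∂(truncNormal μ K) :=
        (integral_finsetSum _ fun b _ => hint b).symm
    _ = ∫ x, h j (x j) * extVec x a * (K *ᵥ (x - μ)) j ∂(truncNormal μ K) := by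
        simp only [hscore]
    _ = _ := by
        refine integral_mul_score_eq μ H.posDef.1 (H.mem.absCont j 0 · le_rfl)
          (H.mem.apply_zero j) j a ?_ ?_ (H.integrable_scoreTerm j a)
        · refine (H.integrable_gammaTerm j a (Sum.inr ())).neg.congr (ae_of_all _ fun x => ?_)
          simp [gammaTerm, extVec]
        · refine (integrable_finsetSum Finset.univ fun b _ => hint b).congr
            (ae_of_all _ fun x => ?_)
          simp only [hscore]

end WeightSetting

end TruncGGM

/-! ### Concentration of the loss and the main theorem -/

namespace TruncGGM

/-- The absolute constant in the deviation bound for the entries of `Γ(x)` and `g(x)`. -/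
noncomputable def devConst : ℝ :=
  (2 * (2 * Real.exp 1 * Real.exp (2 * Real.exp 1)) + 2) * (16 * Real.exp 2)

/-- The absolute constant in the bound for the entries of `E Γ(x)`. -/
noncomputable def popConst : ℝ := 16 * Real.exp 2 * Real.exp 1

/-- The absolute constant in the deviation bound for the amplified matrix. -/
noncomputable def ampConst : ℝ := 2 * devConst + 8 * Real.exp 1 * popConst

theorem devConst_pos : 0 < devConst := by unfold devConst; positivity

theorem popConst_pos : 0 < popConst := by unfold popConst; positivity

theorem ampConst_pos : 0 < ampConst := by
  have := devConst_pos
  have := popConst_pos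
  unfold ampConst
  positivity

theorem devConst_le_ampConst : devConst ≤ ampConst := by
  have h1 := devConst_pos
  have h2 : 0 < 8 * Real.exp 1 * popConst := mul_pos (by positivity) popConst_pos
  unfold ampConst
  linarith

/-- With `Y` the maximum in `C(n, m)`, the quantity `1 - (1 + 4eY)⁻¹` is below both `1` and `4eY`;
`τ > 3` gives `6 log m ≤ 2τ log m`, hence `Y ≤ 2(√T + T)`. -/
theorem sub_one_le_of_lt_multBound {n m : ℕ} (hn : 0 < n) {δ τ : ℝ} (hτ : 3 < τ)
    (hδ : δ < multBound n m) :
    δ - 1 ≤ 1 ∧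
      δ - 1 ≤ 8 * Real.exp 1 * (Real.sqrt (τ * Real.log m / n) + τ * Real.log m / n) := by
  have hn' : (0 : ℝ) < n := by exact_mod_cast hn
  have hL : 0 ≤ Real.log m := Real.log_natCast_nonneg m
  set T := τ * Real.log m / n with hT
  have hT0 : 0 ≤ T := by positivity
  have h6 : 6 * Real.log m / n ≤ 2 * T := by
    rw [hT, ← mul_div_assoc]
    gcongr ?_ / _
    nlinarith
  set Y := max (6 * Real.log m / n) (Real.sqrt (6 * Real.log m / n)) with hY
  have hY0 : 0 ≤ Y := le_max_of_le_right (Real.sqrt_nonneg _)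
  have hYR : Y ≤ 2 * (Real.sqrt T + T) := by
    have hs := Real.sqrt_nonneg T
    refine max_le (by linarith) ?_
    have : Real.sqrt (6 * Real.log m / n) ≤ 2 * Real.sqrt T := by
      rw [Real.sqrt_le_left (by positivity), mul_pow, Real.sq_sqrt hT0]
      linarith
    linarith
  have hpos : 0 < 1 + 4 * Real.exp 1 * Y := by positivity
  have hinv : 1 - 4 * Real.exp 1 * Y ≤ (1 + 4 * Real.exp 1 * Y)⁻¹ := by
    rw [← one_div, le_div_iff₀ hpos]
    nlinarith [sq_nonneg (4 * Real.exp 1 * Y)]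
  have hinv0 : 0 < (1 + 4 * Real.exp 1 * Y)⁻¹ := inv_pos.2 hpos
  have hδ' : δ < 2 - (1 + 4 * Real.exp 1 * Y)⁻¹ := hδ
  refine ⟨by linarith, ?_⟩
  have : 4 * Real.exp 1 * Y ≤ 4 * Real.exp 1 * (2 * (Real.sqrt T + T)) := by gcongr
  linarith

/-- The amplified matrix is close to `G₀` if `Γ(x)` is. -/
theorem abs_gammaAmp_sub_le {n m : ℕ} {h : Fin m → ℝ → ℝ} {δ : ℝ} {x : Matrix (Fin n) (Fin m) ℝ}
    {G₀ : Matrix ((Fin m ⊕ Unit) × Fin m) ((Fin m ⊕ Unit) × Fin m) ℝ} {u R : ℝ} (hu : 0 ≤ u)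
    (hR : 0 ≤ R) (hδ₀ : 0 ≤ δ - 1) (hδ₁ : δ - 1 ≤ 1) (hδR : δ - 1 ≤ 8 * Real.exp 1 * R)
    (hG₀ : ∀ p, |G₀ p p| ≤ popConst * u)
    (hG : ∀ p q, p.2 = q.2 → |gammaMat h x p q - G₀ p q| ≤ devConst * u * R)
    (p q : (Fin m ⊕ Unit) × Fin m) (hpq : p.2 = q.2) :
    |gammaAmp h δ x p q - G₀ p q| ≤ ampConst * u * R := by
  have hpop := popConst_pos
  have hdev := devConst_pos
  -- The bound `δ - 1 ≤ 8eR` is spent on the population part of the diagonal, `δ - 1 ≤ 1` on its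
  -- deviation, so no `R²` appears.
  have hamp : |diagonal (amplifier h δ x) p q| ≤
      8 * Real.exp 1 * R * (popConst * u) + devConst * u * R := by
    have h0 : 0 ≤ 8 * Real.exp 1 * R * (popConst * u) + devConst * u * R := by positivity
    by_cases hne : p = q
    swap
    · rwa [diagonal_apply_ne _ hne, abs_zero]
    subst hne
    rw [diagonal_apply_eq]
    obtain ⟨k | v, j⟩ := p
    · rw [amplifier, abs_mul, abs_of_nonneg hδ₀]
      set p : (Fin m ⊕ Unit) × Fin m := (Sum.inl k, j)
      have h1 : |gammaMat h x p p| ≤ popConst * u + devConst * u * R := by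
        have := abs_add_le (G₀ p p) (gammaMat h x p p - G₀ p p)
        rw [add_sub_cancel] at this
        exact this.trans (add_le_add (hG₀ p) (hG p p rfl))
      calc (δ - 1) * |gammaMat h x p p|
          ≤ (δ - 1) * (popConst * u + devConst * u * R) := by gcongr
        _ = (δ - 1) * (popConst * u) + (δ - 1) * (devConst * u * R) := by ring
        _ ≤ 8 * Real.exp 1 * R * (popConst * u) + 1 * (devConst * u * R) := by gcongr
        _ = _ := by ring
    · simpa [amplifier] using h0
  calc |gammaAmp h δ x p q - G₀ p q|
      = |(gammaMat h x p q - G₀ p q) + diagonal (amplifier h δ x) p q| := by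
        rw [gammaAmp, Matrix.add_apply]; congr 1; ring
    _ ≤ devConst * u * R + (8 * Real.exp 1 * R * (popConst * u) + devConst * u * R) :=
        (abs_add_le _ _).trans (add_le_add (hG p q hpq) hamp)
    _ = _ := by unfold ampConst; ring

/-- The terms with `√T` and `T` are each at most `1/16`: the first needs `T Q²` small, the second `T
Q`. This explains the maximum in the sample size condition. -/
theorem mul_sqrt_add_le_of_sampleSize {D Q T : ℝ} (hD : 0 < D) (hQ : 0 ≤ Q) (hT : 0 ≤ T)
    (h : ((16 * D) ^ 2 + 16 * D) * (T * max (Q ^ 2) Q) ≤ 1) :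
    D * Q * (Real.sqrt T + T) ≤ 1 / 8 := by
  have h1 : T * Q ^ 2 ≤ T * max (Q ^ 2) Q := by gcongr; exact le_max_left _ _
  have h2 : T * Q ≤ T * max (Q ^ 2) Q := by gcongr; exact le_max_right _ _
  have h0 : 0 ≤ T * max (Q ^ 2) Q := le_trans (by positivity) h2
  have h3 : (16 * D * Q * Real.sqrt T) ^ 2 ≤ 1 ^ 2 := by
    rw [mul_pow, Real.sq_sqrt hT, mul_pow]
    nlinarith [sq_nonneg (16 * D)]
  have h4 : 16 * D * Q * Real.sqrt T ≤ 1 := le_of_sq_le_sq h3 zero_le_one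
  have h5 : 16 * D * (T * Q) ≤ 1 := by nlinarith [sq_nonneg (16 * D)]
  nlinarith

/-- There are `m(m+1)²` block entries of `Γ` and `m(m+1)` entries of `g`, with two tails each.
Bernstein leaves `m^(-2τ)`; the spare `m^(-τ) ≤ m^(-3) ≤ 1/8` absorbs the constant, which is where
`m ≥ 2` enters. -/
theorem card_mul_exp_le_rpow {m : ℕ} (hm : 2 ≤ m) {τ : ℝ} (hτ : 3 < τ) :
    2 * (m * (m + 1) * (m + 2)) * Real.exp (-(2 * (τ * Real.log m))) ≤ (m : ℝ) ^ (3 - τ) := by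
  have hm' : (2 : ℝ) ≤ m := by exact_mod_cast hm
  have hm0 : (0 : ℝ) < m := by linarith
  have hL : 0 ≤ Real.log m := Real.log_natCast_nonneg m
  rw [Real.rpow_def_of_pos hm0]
  have h1 : Real.log m * (3 - τ) = Real.log m + Real.log m + Real.log m + τ * Real.log m +
      -(2 * (τ * Real.log m)) := by ring
  rw [h1, Real.exp_add, Real.exp_add, Real.exp_add, Real.exp_add, Real.exp_log hm0]
  refine mul_le_mul_of_nonneg_right ?_ (Real.exp_pos _).le
  have h2 : (m : ℝ) * m * m ≤ Real.exp (τ * Real.log m) := by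
    have : Real.exp (Real.log m + Real.log m + Real.log m) = m * m * m := by
      rw [Real.exp_add, Real.exp_add, Real.exp_log hm0]
    rw [← this, Real.exp_le_exp]
    nlinarith
  have h3 : (8 : ℝ) ≤ m * m * m := by nlinarith
  calc 2 * ((m : ℝ) * (m + 1) * (m + 2)) ≤ m * m * m * 8 := by nlinarith
    _ ≤ _ := by gcongr; linarith

section Concentration

variable {Ω : Type*} [MeasurableSpace Ω] {P : Measure Ω} {n m : ℕ}
  {μ : Fin m → ℝ} {K : Matrix (Fin m) (Fin m) ℝ} {h : Fin m → ℝ → ℝ} {M M' c : ℝ}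
  {X : Fin n → Ω → (Fin m → ℝ)}

theorem gammaPop_apply (H : WeightSetting μ K h M M' c) (hn : 0 < n)
    (hlaw : ∀ i, HasLaw (X i) (truncNormal μ K) P) (p q : (Fin m ⊕ Unit) × Fin m) :
    gammaPop P h X p q =
      if p.2 = q.2 then ∫ x, gammaTerm h p.2 p.1 q.1 x ∂(truncNormal μ K) else 0 := by
  have hn' : (n : ℝ) ≠ 0 := by positivity
  simp only [gammaPop, Matrix.of_apply, gammaMat_apply]
  split_ifs
  swap
  · simp
  have h1 := H.integrable_gammaTerm p.2 p.1 q.1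
  have h2 : ∀ i, ∫ ω, gammaTerm h p.2 p.1 q.1 (X i ω) ∂P =
      ∫ x, gammaTerm h p.2 p.1 q.1 x ∂(truncNormal μ K) := fun i =>
    (hlaw i).integral_comp h1.aestronglyMeasurable
  have h3 : ∀ i, Integrable (fun ω => gammaTerm h p.2 p.1 q.1 (X i ω)) P := fun i => by
    rw [← (hlaw i).map_eq] at h1
    exact h1.comp_aemeasurable (hlaw i).aemeasurable
  change ∫ ω, (n : ℝ)⁻¹ * ∑ i, gammaTerm h p.2 p.1 q.1 (X i ω) ∂P = _
  rw [integral_const_mul, integral_finsetSum _ fun i _ => h3 i]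
  simp only [h2]
  simp
  field_simp

variable [IsProbabilityMeasure P]

/-- With high probability, all entries of `Γ(x)` and `g(x)` are close to their means. -/
theorem measure_exists_deviation_le (H : WeightSetting μ K h M M' c) (hn : 0 < n)
    (hX : iIndepFun X P) (hlaw : ∀ i, HasLaw (X i) (truncNormal μ K) P) {T : ℝ} (hT : 0 ≤ T) :
    P {ω | (∃ j a b, devConst * (M * c ^ 2) * (Real.sqrt T + T) <
          |(n : ℝ)⁻¹ * ∑ i, gammaTerm h j a b (X i ω) -
            ∫ x, gammaTerm h j a b x ∂(truncNormal μ K)|) ∨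
        ∃ j a, devConst * (M' * c + M) * (Real.sqrt T + T) <
          |(n : ℝ)⁻¹ * ∑ i, scoreTerm h j a (X i ω) -
            ∫ x, scoreTerm h j a x ∂(truncNormal μ K)|} ≤
      ENNReal.ofReal (2 * (m * (m + 1) * (m + 2)) * Real.exp (-(2 * (n * T)))) := by
  have := H.prob
  have hc : 0 < c := by linarith [H.one_le]
  set r := 2 * ENNReal.ofReal (Real.exp (-(2 * (n * T)))) with hr
  have hA : 0 ≤ 2 * Real.exp 1 := by positivity
  have h1 : ∀ t : Fin m × (Fin m ⊕ Unit) × (Fin m ⊕ Unit),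
      P {ω | devConst * (M * c ^ 2) * (Real.sqrt T + T) <
          |(n : ℝ)⁻¹ * ∑ i, gammaTerm h t.1 t.2.1 t.2.2 (X i ω) -
            ∫ x, gammaTerm h t.1 t.2.1 t.2.2 x ∂(truncNormal μ K)|} ≤ r := by
    rintro ⟨j, a, b⟩
    have hM := (H.bounds_pos j).1
    have := measure_mean_sub_integral_gt_le hn hX hlaw (H.mem.aemeasurable_gammaTerm μ K j a b)
      (b := 16 * Real.exp 2 * (M * c ^ 2)) (by positivity) hA hT (H.lintegral_exp_gammaTerm_le j a b)
    rwa [← mul_assoc (2 * _ + 2)] at this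
  have h2 : ∀ t : Fin m × (Fin m ⊕ Unit),
      P {ω | devConst * (M' * c + M) * (Real.sqrt T + T) <
          |(n : ℝ)⁻¹ * ∑ i, scoreTerm h t.1 t.2 (X i ω) -
            ∫ x, scoreTerm h t.1 t.2 x ∂(truncNormal μ K)|} ≤ r := by
    rintro ⟨j, a⟩
    obtain ⟨hM, hM'⟩ := H.bounds_pos j
    have := measure_mean_sub_integral_gt_le hn hX hlaw (H.mem.aemeasurable_scoreTerm μ K j a)
      (b := 16 * Real.exp 2 * (M' * c + M)) (by positivity) hA hT (H.lintegral_exp_scoreTerm_le j a)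
    rwa [← mul_assoc (2 * _ + 2)] at this
  have hunion : ∀ {ι : Type} [Fintype ι] (s : ι → Set Ω), (∀ t, P (s t) ≤ r) →
      P (⋃ t, s t) ≤ Fintype.card ι * r := fun s hs =>
    (measure_iUnion_fintype_le P s).trans
      ((Finset.sum_le_card_nsmul _ _ _ fun t _ => hs t).trans_eq (by simp [Finset.card_univ]))
  refine (measure_mono fun ω hω => ?_).trans
    ((measure_union_le _ _).trans (add_le_add (hunion _ h1) (hunion _ h2)) |>.trans_eq ?_)
  · rcases hω with ⟨j, a, b, h3⟩ | ⟨j, a, h3⟩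
    · exact Or.inl (mem_iUnion.2 ⟨(j, a, b), h3⟩)
    · exact Or.inr (mem_iUnion.2 ⟨(j, a), h3⟩)
  · have h4 : ((2 * (m * (m + 1) * (m + 2)) : ℕ) : ℝ) = 2 * (m * (m + 1) * (m + 2)) := by
      push_cast; ring
    rw [← h4, ENNReal.ofReal_mul (by positivity), ENNReal.ofReal_natCast, hr]
    simp only [Fintype.card_prod, Fintype.card_sum, Fintype.card_fin, Fintype.card_unit]
    push_cast
    ring

end Concentration

end TruncGGM

end Auxiliary

/-! ### Assembly of the theorem. -/

theorem mainTheorem12 :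
    ∃ C₁ C₂ : ℝ, 0 < C₁ ∧ 0 < C₂ ∧
      ∀ {Ω : Type*} [MeasurableSpace Ω] (P : Measure Ω) [IsProbabilityMeasure P]
        (n m : ℕ) (μ₀ : Fin m → ℝ) (K₀ : Matrix (Fin m) (Fin m) ℝ) (_ : K₀.PosDef)
        (X : Fin n → Ω → (Fin m → ℝ)) (_ : iIndepFun X P)
        (_ : ∀ i, HasLaw (X i) (TruncGGM.truncNormal μ₀ K₀) P)
        (h : Fin m → ℝ → ℝ) (_ : TruncGGM.MemH11 h) (M M' : ℝ)
        (_ : ∀ j, ∀ᵐ x ∂(volume.restrict (Ioi (0 : ℝ))), 0 ≤ h j x ∧ h j x ≤ M)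
        (_ : ∀ j, ∀ᵐ x ∂(volume.restrict (Ioi (0 : ℝ))), 0 ≤ deriv (h j) x ∧ deriv (h j) x ≤ M')
        (δ : ℝ) (_ : 1 < δ) (_ : δ < TruncGGM.multBound n m)
        (α : ℝ) (_ : 0 < α) (_ : α ≤ 1)
        (η₀ : Fin m → ℝ) (_ : η₀ = K₀ *ᵥ μ₀)
        (Ψ₀ : Matrix (Fin m ⊕ Unit) (Fin m) ℝ) (_ : Ψ₀ = TruncGGM.mkPsi K₀ η₀)
        (_ : TruncGGM.Irrepresentable (TruncGGM.gammaPop P h X) (TruncGGM.supp Ψ₀) α)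
        (cG cP d cx : ℝ)
        (_ : cG = TruncGGM.cGamma (TruncGGM.gammaPop P h X) (TruncGGM.supp Ψ₀))
        (_ : cP = TruncGGM.rowSumNorm Ψ₀ᵀ)
        (_ : d = TruncGGM.maxColCount Ψ₀)
        (_ : cx = max 1 (TruncGGM.cX μ₀ K₀))
        (τ : ℝ) (_ : 3 < τ)
        (_ : C₁ * (τ * Real.log m *
          max (M ^ 2 * cG ^ 2 * cx ^ 4 * d ^ 2 / α ^ 2) (M * cG * cx ^ 2 * d / α)) < n)
        (lam : ℝ)
        (_ : C₂ * ((2 - α) / α) * ((M * cP * cx ^ 2 + M' * cx + M) *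
          (Real.sqrt (τ * Real.log m / n) + τ * Real.log m / n)) < lam),
        P {ω | ¬ ∃ Ψ, TruncGGM.GoodEstimate h δ lam (TruncGGM.dataMat X ω) K₀ η₀
            (2 * cG / (2 - α) * lam) Ψ} ≤ ENNReal.ofReal ((m : ℝ) ^ (3 - τ)) := by
  -- `C₁` is the constant of `mul_sqrt_add_le_of_sampleSize`; the `4` in `C₂` matches the
  -- requirement `(2 - α) ρ ≤ α λ / 4` of the witness argument.
  refine ⟨(16 * TruncGGM.ampConst) ^ 2 + 16 * TruncGGM.ampConst, 4 * TruncGGM.ampConst,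
    add_pos (pow_pos (mul_pos (by norm_num) TruncGGM.ampConst_pos) 2)
      (mul_pos (by norm_num) TruncGGM.ampConst_pos), mul_pos (by norm_num) TruncGGM.ampConst_pos, ?_⟩
  intro Ω _ P _ n m μ₀ K₀ hK₀ X hX hlaw h hh M M' hM hM' δ hδ hδ' α hα hα₁ η₀ hη₀ Ψ₀ hΨ₀ hirr
    cG cP d cx hcG hcP hd hcx τ hτ hn lam hlam
  have hK₀t : K₀ᵀ = K₀ := by simpa using hK₀.1.eq
  have hcG0 : 0 ≤ cG := hcG ▸ TruncGGM.cGamma_nonneg _ _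
  have hcP0 : 0 ≤ cP := hcP ▸ TruncGGM.rowSumNorm_nonneg _
  have hD := TruncGGM.ampConst_pos
  -- For `m = 0` there is only one parameter matrix and the failure event is empty; for `m = 1` the
  -- probability bound is `1`.
  rcases Nat.eq_zero_or_pos m with rfl | hm
  · have hlam0 : 0 < lam := by simpa using hlam
    have hB : 0 ≤ 2 * cG / (2 - α) * lam :=
      mul_nonneg (div_nonneg (by positivity) (by linarith)) hlam0.le
    have hempty : {ω | ¬ ∃ Ψ, TruncGGM.GoodEstimate h δ lam (TruncGGM.dataMat X ω) K₀ η₀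
        (2 * cG / (2 - α) * lam) Ψ} = ∅ := by
      ext ω
      simp only [mem_ofPred_eq, mem_empty_iff_false, iff_false, not_not]
      exact ⟨0, TruncGGM.goodEstimate_of_entrywise hK₀t hB
        (fun Φ => by rw [Subsingleton.elim Φ 0]) (fun Φ _ => Subsingleton.elim _ _)
        (fun p => p.2.elim0) (fun _ j => j.elim0)⟩
    rw [hempty]
    simp
  rcases Nat.lt_or_ge m 2 with hm2 | hm2
  · obtain rfl : m = 1 := by omega
    simpa using prob_le_one
  set j₀ : Fin m := ⟨0, hm⟩
  have hL : 0 ≤ Real.log m := Real.log_natCast_nonneg m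
  have hd0 : 0 ≤ d := by rw [hd]; positivity
  have hcx1 : 1 ≤ cx := hcx ▸ le_max_left _ _
  have hmax0 : 0 ≤ max (M ^ 2 * cG ^ 2 * cx ^ 4 * d ^ 2 / α ^ 2) (M * cG * cx ^ 2 * d / α) :=
    le_max_of_le_left (by positivity)
  have hn0 : 0 < n := by
    have h1 : (0 : ℝ) < n := lt_of_le_of_lt (by positivity) hn
    exact_mod_cast h1
  have hn' : (0 : ℝ) < n := by exact_mod_cast hn0
  -- Normalizability is inherited from the law of an observation, which exists since `n > 0`.
  have hprob : IsProbabilityMeasure (TruncGGM.truncNormal μ₀ K₀) := by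
    rw [← (hlaw ⟨0, hn0⟩).map_eq]
    exact Measure.isProbabilityMeasure_map (hlaw ⟨0, hn0⟩).aemeasurable
  have H : TruncGGM.WeightSetting μ₀ K₀ h M M' cx :=
    ⟨hK₀, hprob, hh, hM, hM', hcx1, hcx ▸ le_max_right _ _⟩
  obtain ⟨hM0, hM'0⟩ := H.bounds_pos j₀
  obtain ⟨hδ₁, hδR⟩ := TruncGGM.sub_one_le_of_lt_multBound hn0 hτ hδ'
  set T := τ * Real.log m / n with hT
  have hT0 : 0 ≤ T := by positivity
  have hnT : n * T = τ * Real.log m := by rw [hT]; field_simp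
  set R := Real.sqrt T + T with hR
  have hR0 : 0 ≤ R := by positivity
  have h2α : 0 < 2 - α := by linarith
  have hlam0 : 0 < lam := lt_of_le_of_lt (by positivity) hlam
  have hsize : TruncGGM.ampConst * (M * cG * cx ^ 2 * d / α) * R ≤ 1 / 8 := by
    refine TruncGGM.mul_sqrt_add_le_of_sampleSize hD (by positivity) hT0 ?_
    have h1 : (M * cG * cx ^ 2 * d / α) ^ 2 = M ^ 2 * cG ^ 2 * cx ^ 4 * d ^ 2 / α ^ 2 := by ring
    rw [h1]
    rw [← hnT] at hn
    refine le_of_mul_le_mul_left ?_ hn'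
    rw [mul_one]
    refine le_trans (le_of_eq ?_) hn.le
    ring
  have hdev : ∀ᵐ ω ∂P, ∀ i j, 0 < X i ω j ∧ 0 < h j (X i ω j) := by
    rw [ae_all_iff]
    intro i
    have h1 := H.ae_bounds
    rw [← (hlaw i).map_eq] at h1
    filter_upwards [ae_of_ae_map (hlaw i).aemeasurable h1] with ω hω j
    exact ⟨(hω j).1, (hω j).2.1.1⟩
  have hbad := TruncGGM.measure_exists_deviation_le H hn0 hX hlaw hT0
  -- Up to a null set where positivity fails, failure of the conclusion forces a deviation of some
  -- entry.
  refine (measure_mono_ae ?_).trans (hbad.trans (ENNReal.ofReal_le_ofReal ?_))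
  swap
  · rw [hnT]
    exact TruncGGM.card_mul_exp_le_rpow hm2 hτ
  filter_upwards [hdev] with ω hω hfail
  by_contra hgood
  refine hfail ?_
  have hgood' := not_or.1 hgood
  have hpopE := TruncGGM.gammaPop_apply H hn0 hlaw
  have hG : ∀ p q : (Fin m ⊕ Unit) × Fin m, p.2 = q.2 →
      |TruncGGM.gammaMat h (TruncGGM.dataMat X ω) p q - TruncGGM.gammaPop P h X p q| ≤
        TruncGGM.devConst * (M * cx ^ 2) * R := by
    intro p q hpq
    by_contra! hcon
    rw [hpopE, TruncGGM.gammaMat_apply, if_pos hpq, if_pos hpq] at hcon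
    exact hgood'.1 ⟨_, _, _, hcon⟩
  have hg : ∀ p : (Fin m ⊕ Unit) × Fin m,
      |TruncGGM.gVec h (TruncGGM.dataMat X ω) p -
        ∫ x, TruncGGM.scoreTerm h p.2 p.1 x ∂(TruncGGM.truncNormal μ₀ K₀)| ≤
        TruncGGM.devConst * (M' * cx + M) * R := by
    intro p
    by_contra! hcon
    rw [TruncGGM.gVec_apply] at hcon
    exact hgood'.2 ⟨_, _, hcon⟩
  have hamp := TruncGGM.abs_gammaAmp_sub_le (δ := δ) (u := M * cx ^ 2) (by positivity) hR0
    (by linarith) hδ₁ hδR (fun p => by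
      rw [hpopE, if_pos rfl]; exact H.abs_integral_gammaTerm_le _ _ _) hG
  rw [hcG, hΨ₀]
  refine TruncGGM.exists_goodEstimate_of_abs_sub_le hn0 hδ hlam0 (fun i j => (hω i j).1)
    (fun i j => (hω i j).2) hK₀t (fun p q hpq => by rw [hpopE, if_neg hpq])
    (g₀ := fun p => ∫ x, TruncGGM.scoreTerm h p.2 p.1 x ∂(TruncGGM.truncNormal μ₀ K₀))
    (funext fun p => ?_) hα hα₁ (hΨ₀ ▸ hirr)
    (ε₁ := TruncGGM.ampConst * (M * cx ^ 2) * R) (by positivity) hamp hg ?_ ?_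
  · rw [← H.sum_integral_gammaTerm_mul_eq p.2 p.1, ← hη₀]
    simp only [mulVec, dotProduct, Fintype.sum_prod_type, hpopE, ite_mul, zero_mul,
      Finset.sum_ite_eq, Finset.mem_univ, if_true]
    rfl
  · rw [← hΨ₀, ← hcG, ← hd]
    have h1 : cG * (TruncGGM.ampConst * (M * cx ^ 2) * R * d) =
        α * (TruncGGM.ampConst * (M * cG * cx ^ 2 * d / α) * R) := by field_simp
    rw [h1]
    nlinarith
  · rw [← hΨ₀, ← hcP]
    have h1 : TruncGGM.devConst * (M' * cx + M) * R ≤ TruncGGM.ampConst * (M' * cx + M) * R := by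
      gcongr; exact TruncGGM.devConst_le_ampConst
    have h2 : 4 * TruncGGM.ampConst * ((2 - α) / α) * ((M * cP * cx ^ 2 + M' * cx + M) * R) =
        4 * ((2 - α) * (TruncGGM.ampConst * (M' * cx + M) * R +
          TruncGGM.ampConst * (M * cx ^ 2) * R * cP)) / α := by
      field_simp; ring
    rw [h2, div_lt_iff₀ hα] at hlam
    calc _ ≤ (2 - α) * (TruncGGM.ampConst * (M' * cx + M) * R +
          TruncGGM.ampConst * (M * cx ^ 2) * R * cP) := by gcongr
      _ ≤ α * lam / 4 := by linarith
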